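/- Let $d\ge 1$ be an integer, $h>0$, $k_s=2\pi/h$ and $\sigma=h/\pi$, so that $\sigma k_s/2=1$. For $\nu\in\mathbb R$ and $x>0$ let $J_\nu(x)=\sum_{m\ge 0}\frac{(-1)^m}{m!\,\Gamma(m+\nu+1)}\left(\frac x2\right)^{2m+\nu}$ be the Bessel function of the first kind. Define, for $\rho>0$, $$\zeta(\rho)=\frac{J_{d/2}(\rho)}{(2\pi\sigma^2\rho)^{d/2}},$$ and let, for $k\ge 0$, $\widehat\zeta(k)=1$ if $k<k_s/2$, $\widehat\zeta(k)=1/2$ if $k=k_s/2$, and $\widehat\zeta(k)=0$ if $k>k_s/2$. Then $\zeta$, as the radial function $x\mapsto\zeta(|x|/\sigma)$ on $\mathbb R^d$, has Fourier transform $\widehat\zeta$, in the following senses. (a) For every $k>0$, with $s=\sigma k$, the radial Fourier transform converges as an improper integral (as the upper limit tends to infinity) and $$(2\pi\sigma^2)^{d/2}\int_0^\infty \zeta(\rho)\,\frac{J_{d/2-1}(s\rho)}{(s\rho)^{d/2-1}}\,\rho^{d-1}\,d\rho=\widehat\zeta(k).$$ (b) The function $x\mapsto\zeta(|x|/\sigma)$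 is integrable on every ball centred at the origin, and for every $k\in\mathbb R^d$ with $k\neq 0$, $$\lim_{R\to\infty}\int_{|x|<R}\zeta(|x|/\sigma)\,e^{-i k\cdot x}\,dx=\widehat\zeta(|k|).$$ (c) Conversely, $\zeta$ is the inverse Fourier transform of $\widehat\zeta$: for every $x\in\mathbb R^d$ with $x\neq 0$, $$\zeta(|x|/\sigma)=\frac1{(2\pi)^d}\int_{\mathbb R^d}\widehat\zeta(|k|)\,e^{i k\cdot x}\,dk .$$ -/

import Mathlib

open Filter Topology MeasureTheory

noncomputable section

namespace SpectralCutoff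

/-- The `m`-th term of the power series of the Bessel function of the first kind,
`(-1)^m / (m! Γ(m + ν + 1)) (x/2)^(2m + ν)`. At the poles of `Γ` the value `1 / 0 = 0` is the
usual convention `1 / Γ = 0`. -/
def besselTerm (ν x : ℝ) (m : ℕ) : ℝ :=
  (-1) ^ m / ((m.factorial : ℝ) * Real.Gamma ((m : ℝ) + ν + 1)) * (x / 2) ^ (2 * (m : ℝ) + ν)

/-- The Bessel function of the first kind `J_ν(x)`, of real order `ν`, at real `x > 0`. -/
def besselJ (ν x : ℝ) : ℝ := ∑' m : ℕ, besselTerm ν x m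

/-- The series that defines `J_ν(x)` converges. -/
theorem summable_besselTerm (ν : ℝ) {x : ℝ} (hx : 0 < x) : Summable (besselTerm ν x) := by
  have hx2 : 0 < x / 2 := by positivity
  have hlin : Tendsto (fun m : ℕ => (m : ℝ) + ν + 1) atTop atTop := by
    have := tendsto_atTop_add_const_right atTop (ν + 1) (tendsto_natCast_atTop_atTop (R := ℝ))
    simpa [add_assoc] using this
  have hev : ∀ᶠ m : ℕ in atTop, 0 < (m : ℝ) + ν + 1 := hlin.eventually_gt_atTop 0
  have hfac : Tendsto (fun m : ℕ => (m : ℝ) + 1) atTop atTop :=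
    tendsto_atTop_add_const_right atTop 1 (tendsto_natCast_atTop_atTop (R := ℝ))
  have hlim : Tendsto (fun m : ℕ => (x / 2) ^ 2 / (((m : ℝ) + 1) * ((m : ℝ) + ν + 1)))
      atTop (𝓝 0) := (hfac.atTop_mul_atTop₀ hlin).const_div_atTop _
  refine summable_of_ratio_test_tendsto_lt_one (l := 0) one_pos ?_ (hlim.congr' ?_)
  · filter_upwards [hev] with m hm
    have h1 : Real.Gamma ((m : ℝ) + ν + 1) ≠ 0 := (Real.Gamma_pos_of_pos hm).ne'
    have h2 : (x / 2) ^ (2 * (m : ℝ) + ν) ≠ 0 := (Real.rpow_pos_of_pos hx2 _).ne'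
    have h3 : (m.factorial : ℝ) ≠ 0 := by positivity
    unfold besselTerm
    exact mul_ne_zero (div_ne_zero (by simp) (mul_ne_zero h3 h1)) h2
  · filter_upwards [hev] with m hm
    have h1 : 0 < Real.Gamma ((m : ℝ) + ν + 1) := Real.Gamma_pos_of_pos hm
    have h2 : 0 < (x / 2) ^ (2 * (m : ℝ) + ν) := Real.rpow_pos_of_pos hx2 _
    have h3 : (0 : ℝ) < m.factorial := by positivity
    have hG : Real.Gamma (((m + 1 : ℕ) : ℝ) + ν + 1)
        = ((m : ℝ) + ν + 1) * Real.Gamma ((m : ℝ) + ν + 1) := by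
      rw [← Real.Gamma_add_one hm.ne']; push_cast; ring_nf
    have hP : (x / 2) ^ (2 * ((m + 1 : ℕ) : ℝ) + ν)
        = (x / 2) ^ 2 * (x / 2) ^ (2 * (m : ℝ) + ν) := by
      rw [← Real.rpow_natCast (x / 2) 2, ← Real.rpow_add hx2]; push_cast; ring_nf
    unfold besselTerm
    rw [hG, hP, Nat.factorial_succ]
    simp only [norm_mul, norm_div, norm_pow, norm_neg, norm_one, one_pow, Real.norm_eq_abs,
      abs_of_pos h1, abs_of_pos h2, abs_of_pos hx, abs_of_pos (two_pos (α := ℝ)), abs_of_pos hm, Nat.abs_cast]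
    push_cast
    field_simp

/-- The angular sampling wave-number `k_s = 2π / h` of the discretization length `h`. -/
def samplingWavenumber (h : ℝ) : ℝ := 2 * Real.pi / h

/-- The length scale `σ = h / π`. -/
def sigma (h : ℝ) : ℝ := h / Real.pi

/-- The sharp spectral cut-off at the wave-number `K`. -/
def cutoff (K k : ℝ) : ℝ := if k < K then 1 else if k = K then 1 / 2 else 0

/-- The real-space regularization function `ζ(ρ) = J_{d/2}(ρ) / (2πσ²ρ)^{d/2}`, for `ρ > 0`. -/
def zeta (d : ℕ) (σ ρ : ℝ) : ℝ :=
  besselJ ((d : ℝ) / 2) ρ / (2 * Real.pi * σ ^ 2 * ρ) ^ ((d : ℝ) / 2)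

/-- `a` is the value at the normalized wave-number `s` of the `d`-dimensional Fourier transform in
polar coordinates of the radial function `f`, with `f` in the normalized radius `ρ = r / σ`:
`a = (2πσ²)^{d/2} ∫_0^∞ f(ρ) J_{d/2-1}(sρ) / (sρ)^{d/2-1} ρ^{d-1} dρ`, as a convergent improper
integral. -/
def HasRadialFourierTransformAt (d : ℕ) (σ : ℝ) (f : ℝ → ℝ) (s a : ℝ) : Prop :=
  (∀ R : ℝ, 0 < R → IntervalIntegrable (fun ρ : ℝ =>
      f ρ * (besselJ ((d : ℝ) / 2 - 1) (s * ρ) / (s * ρ) ^ ((d : ℝ) / 2 - 1)) * ρ ^ (d - 1))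
      volume 0 R) ∧
    Tendsto (fun R : ℝ => (2 * Real.pi * σ ^ 2) ^ ((d : ℝ) / 2) *
      ∫ ρ in (0 : ℝ)..R,
        f ρ * (besselJ ((d : ℝ) / 2 - 1) (s * ρ) / (s * ρ) ^ ((d : ℝ) / 2 - 1)) * ρ ^ (d - 1))
      atTop (𝓝 a)

/-- `a` is the value at the angular wave-vector `k` of the Fourier transform
`∫ F(x) e^{-i k·x} dx` over `ℝ^d`, as the limit of the integrals over centred balls. -/
def HasFourierTransformAt {d : ℕ} (F : EuclideanSpace ℝ (Fin d) → ℂ)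
    (k : EuclideanSpace ℝ (Fin d)) (a : ℂ) : Prop :=
  (∀ R : ℝ, IntegrableOn F (Metric.ball 0 R)) ∧
    Tendsto (fun R : ℝ => ∫ x in Metric.ball (0 : EuclideanSpace ℝ (Fin d)) R,
      F x * Complex.exp (-(Complex.I * (inner ℝ k x : ℝ)))) atTop (𝓝 a)

end SpectralCutoff

end

/-! Write N_ν(x) = J_ν(x) / (x/2)^ν, an entire function (`besselNorm`). Up to a constant, ζ is
N_{d/2}, so no singular power remains at the origin. Part (a), and part (b) after passing to polar
coordinates, both reduce to the discontinuous Weber–Schafheitlin integral I_d(s, R) = ∫_0^R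
(ρ/2)^{d-1} N_{d/2}(ρ) N_{d/2-1}(sρ) dρ, whose limit as R → ∞ is 1, 1/2 or 0 according as s < 1, s =
1 or s > 1 (`tendsto_radialIntegral`).

Integration by parts shows that I_{d+2} and I_d differ by a boundary term, which is O(1/R) because
J_{d/2}(x) = O(x^{-1/2}). Hence d = 1 and d = 2 suffice. For d = 1 the integrand is a multiple of
sin ρ cos(sρ) / ρ, a sum of two Dirichlet integrals, and the jump is the sign of 1 - s. For d = 2
and s < 1, differentiation in s gives a linear differential equation for an auxiliary integral, with
a source that vanishes as R → ∞. An identity relating s to 1/s then settles s = 1 and s > 1.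

Polar coordinates enter through the Fourier transform of the unit sphere, a multiple of
N_{d/2-1}(|k|), computed from Gaussian moments (`integral_sphere_exp`). Integrating it over radii
gives the transform of a ball as a multiple of N_{d/2}, which is (c). -/

namespace SpectralCutoff

/-! ### Normalized Bessel functions: series, derivative, recurrence -/

/-- The `m`-th coefficient of the power series `∑ (-1)^m y^m / (m! Γ(m + ν + 1))`. -/
noncomputable def besselCoeff (ν : ℝ) (m : ℕ) : ℝ :=
  (-1) ^ m / ((m.factorial : ℝ) * Real.Gamma ((m : ℝ) + ν + 1))

/-- The entire function `∑ (-1)^m y^m / (m! Γ(m + ν + 1))`. -/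
noncomputable def besselClifford (ν y : ℝ) : ℝ := ∑' m : ℕ, besselCoeff ν m * y ^ m

/-- The normalized Bessel function `J_ν(x) / (x/2)^ν`, as an entire function. -/
noncomputable def besselNorm (ν x : ℝ) : ℝ := besselClifford ν ((x / 2) ^ 2)

theorem besselTerm_eq (ν : ℝ) {x : ℝ} (hx : 0 < x) (m : ℕ) :
    besselTerm ν x m = (x / 2) ^ ν * (besselCoeff ν m * ((x / 2) ^ 2) ^ m) := by
  have hx2 : 0 < x / 2 := by positivity
  rw [besselTerm, besselCoeff, Real.rpow_add hx2, ← pow_mul, ← Real.rpow_natCast (x / 2) (2 * m)]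
  push_cast
  ring

theorem besselJ_eq (ν : ℝ) {x : ℝ} (hx : 0 < x) :
    besselJ ν x = (x / 2) ^ ν * besselNorm ν x := by
  rw [besselJ, besselNorm, besselClifford, ← tsum_mul_left]
  exact tsum_congr fun m => besselTerm_eq ν hx m

theorem summable_abs_besselCoeff (ν y : ℝ) : Summable fun m => |besselCoeff ν m| * |y| ^ m := by
  have hB : 0 < |y| + 1 := by positivity
  -- At this point (x/2)² = |y| + 1; the added 1 keeps x positive even when y = 0.
  have hx : 0 < 2 * √(|y| + 1) := by positivity
  have h := (summable_besselTerm ν hx).abs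
  have hc : ((2 * √(|y| + 1)) / 2) ^ ν ≠ 0 := (Real.rpow_pos_of_pos (by positivity) _).ne'
  have h2 : Summable fun m => |besselCoeff ν m * (|y| + 1) ^ m| := by
    have := (summable_mul_left_iff (abs_ne_zero.2 hc)).1 (h.congr fun m => by
      rw [besselTerm_eq ν hx, abs_mul])
    refine this.congr fun m => ?_
    rw [mul_div_cancel_left₀ _ (two_ne_zero), Real.sq_sqrt hB.le]
  refine Summable.of_nonneg_of_le (fun m => by positivity) (fun m => ?_) h2
  rw [abs_mul, abs_pow, abs_of_pos hB]
  gcongr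
  linarith

theorem summable_besselCoeff (ν y : ℝ) : Summable fun m => besselCoeff ν m * y ^ m := by
  refine Summable.of_abs ?_
  simpa [abs_mul, abs_pow] using summable_abs_besselCoeff ν y

/-- Coefficient form of the derivative rule. At a pole of Γ both sides are 0 by the convention 1 / 0
= 0. -/
theorem besselCoeff_succ (ν : ℝ) (m : ℕ) :
    besselCoeff ν (m + 1) * ((m + 1 : ℕ) : ℝ) = -besselCoeff (ν + 1) m := by
  have : (m.factorial : ℝ) ≠ 0 := by positivity
  have h1 : ((m : ℝ) + 1) ≠ 0 := by positivity
  have hG : ((m + 1 : ℕ) : ℝ) + ν + 1 = (m : ℝ) + (ν + 1) + 1 := by push_cast; ring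
  rw [besselCoeff, besselCoeff, hG, Nat.factorial_succ]
  rcases eq_or_ne (Real.Gamma ((m : ℝ) + (ν + 1) + 1)) 0 with h | h
  · simp [h]
  · push_cast
    field_simp
    ring

theorem hasDerivAt_besselClifford (ν y : ℝ) :
    HasDerivAt (besselClifford ν) (-besselClifford (ν + 1) y) y := by
  set B : ℝ := |y| + 1
  have hu : Summable fun m : ℕ => |besselCoeff ν m| * (m * B ^ (m - 1)) := by
    rw [← summable_nat_add_iff 1]
    refine (summable_abs_besselCoeff (ν + 1) B).congr fun m => ?_
    rw [← abs_neg (besselCoeff (ν + 1) m), ← besselCoeff_succ, abs_mul, Nat.abs_cast,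
      abs_of_nonneg (show 0 ≤ B by positivity), mul_assoc, Nat.add_sub_cancel]
  have key := hasDerivAt_tsum_of_isPreconnected (g := fun m y => besselCoeff ν m * y ^ m)
    (g' := fun m y => besselCoeff ν m * (m * y ^ (m - 1))) (t := Metric.ball 0 B)
    hu Metric.isOpen_ball (convex_ball _ _).isPreconnected
    (fun m z _ => (hasDerivAt_pow m z).const_mul _)
    (fun m z hz => by
      have hz' : |z| ≤ B := by simpa using (mem_ball_zero_iff.1 hz).le
      rw [norm_mul, norm_mul, norm_pow, Real.norm_eq_abs, Real.norm_eq_abs, Real.norm_eq_abs,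
        Nat.abs_cast]
      gcongr)
    (y₀ := 0) (by simpa using (by positivity : 0 < B)) (summable_besselCoeff ν 0)
    (y := y) (by simp [B])
  refine key.congr_deriv ?_
  have hs : Summable fun m : ℕ => besselCoeff ν m * (m * y ^ (m - 1)) := by
    refine Summable.of_norm_bounded hu fun m => ?_
    rw [norm_mul, norm_mul, norm_pow, Real.norm_eq_abs, Real.norm_eq_abs, Real.norm_eq_abs,
        Nat.abs_cast]
    gcongr
    simp [B]
  rw [hs.tsum_eq_zero_add, besselClifford, ← tsum_neg]
  simp only [Nat.cast_zero, zero_mul, mul_zero, zero_add]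
  refine tsum_congr fun m => ?_
  rw [← mul_assoc, besselCoeff_succ, Nat.add_sub_cancel, neg_mul]

theorem besselCoeff_zero (ν : ℝ) : besselCoeff ν 0 = 1 / Real.Gamma (ν + 1) := by
  simp [besselCoeff]

/-- Series form of J_{ν-1}(x) + J_{ν+1}(x) = (2ν/x) J_ν(x), compared coefficient by coefficient
through Γ(z + 1) = z Γ(z). -/
theorem besselClifford_recurrence {ν : ℝ} (hν : 0 ≤ ν) (y : ℝ) :
    besselClifford (ν - 1) y = ν * besselClifford ν y - y * besselClifford (ν + 1) y := by
  have h1 := summable_besselCoeff (ν - 1) y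
  have h2 := summable_besselCoeff ν y
  have h3 := summable_besselCoeff (ν + 1) y
  rw [besselClifford, besselClifford, besselClifford, h1.tsum_eq_zero_add, h2.tsum_eq_zero_add,
    mul_add, ← tsum_mul_left, ← tsum_mul_left, add_sub_assoc,
    ← (((summable_nat_add_iff 1).2 h2).mul_left ν).tsum_sub (h3.mul_left y)]
  congr 1
  · rw [besselCoeff_zero, besselCoeff_zero, sub_add_cancel]
    rcases hν.eq_or_lt with rfl | h
    -- The convention 1 / Γ(0) = 0 matches the factor ν = 0.
    · simp [Real.Gamma_zero]
    · have := (Real.Gamma_pos_of_pos h).ne'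
      rw [Real.Gamma_add_one h.ne']
      field_simp
  · refine tsum_congr fun m => ?_
    have hp : 0 < (m : ℝ) + ν + 1 := by positivity
    have hG : Real.Gamma ((m : ℝ) + ν + 1 + 1) = ((m : ℝ) + ν + 1) * Real.Gamma (m + ν + 1) :=
      Real.Gamma_add_one hp.ne'
    have hG0 := (Real.Gamma_pos_of_pos hp).ne'
    have e1 : ((m + 1 : ℕ) : ℝ) + (ν - 1) + 1 = m + ν + 1 := by push_cast; ring
    have e2 : ((m + 1 : ℕ) : ℝ) + ν + 1 = m + ν + 1 + 1 := by push_cast; ring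
    have e3 : (m : ℝ) + (ν + 1) + 1 = m + ν + 1 + 1 := by ring
    have hf : (m.factorial : ℝ) ≠ 0 := by positivity
    have h1 : ((m : ℝ) + 1) ≠ 0 := by positivity
    rw [besselCoeff, besselCoeff, besselCoeff, e1, e2, e3, hG, Nat.factorial_succ]
    push_cast
    field_simp
    ring

theorem hasDerivAt_besselNorm (ν x : ℝ) :
    HasDerivAt (besselNorm ν) (-(x / 2) * besselNorm (ν + 1) x) x := by
  have h : HasDerivAt (fun x : ℝ => (x / 2) ^ 2) (x / 2) x := by
    refine (((hasDerivAt_id x).div_const 2).pow 2).congr_deriv ?_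
    simp; ring
  refine ((hasDerivAt_besselClifford ν ((x / 2) ^ 2)).comp x h).congr_deriv ?_
  rw [besselNorm]; ring

theorem continuous_besselNorm (ν : ℝ) : Continuous (besselNorm ν) :=
  continuous_iff_continuousAt.2 fun x => (hasDerivAt_besselNorm ν x).continuousAt

theorem besselNorm_recurrence {ν : ℝ} (hν : 0 ≤ ν) (x : ℝ) :
    besselNorm (ν - 1) x = ν * besselNorm ν x - (x / 2) ^ 2 * besselNorm (ν + 1) x :=
  besselClifford_recurrence hν _

theorem besselNorm_zero_right (ν : ℝ) : besselNorm ν 0 = 1 / Real.Gamma (ν + 1) := by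
  rw [besselNorm, besselClifford, tsum_eq_single 0 (fun m hm => by simp [hm]), besselCoeff_zero]
  simp

/-! ### Orders -1/2 and 1/2 -/

theorem Gamma_natCast_add_half (m : ℕ) :
    Real.Gamma (m + 1 / 2) = ((2 * m).factorial : ℝ) * √Real.pi / (4 ^ m * m.factorial) := by
  induction m with
  | zero => simpa using Real.Gamma_one_half_eq
  | succ m ih =>
    have h : ((m + 1 : ℕ) : ℝ) + 1 / 2 = (m + 1 / 2) + 1 := by push_cast; ring
    have hf : (m.factorial : ℝ) ≠ 0 := by positivity
    have h1 : ((m : ℝ) + 1) ≠ 0 := by positivity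
    rw [h, Real.Gamma_add_one (by positivity), ih, show 2 * (m + 1) = 2 * m + 1 + 1 by ring,
      Nat.factorial_succ, Nat.factorial_succ, Nat.factorial_succ]
    push_cast
    field_simp
    ring

theorem besselNorm_neg_half (x : ℝ) : besselNorm (-(1 / 2)) x = Real.cos x / √Real.pi := by
  have hπ : √Real.pi ≠ 0 := by positivity
  rw [Real.cos_eq_tsum, besselNorm, besselClifford, ← tsum_div_const]
  refine tsum_congr fun m => ?_
  have hf : (m.factorial : ℝ) ≠ 0 := by positivity
  have hf2 : ((2 * m).factorial : ℝ) ≠ 0 := by positivity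
  rw [besselCoeff, show (m : ℝ) + -(1 / 2) + 1 = m + 1 / 2 by ring, Gamma_natCast_add_half,
    pow_mul x, div_pow, div_pow, show (2 : ℝ) ^ 2 = 4 by norm_num]
  field_simp

/-- Obtained by differentiating the cosine formula for order -1/2. -/
theorem mul_besselNorm_half (x : ℝ) : x / 2 * besselNorm (1 / 2) x = Real.sin x / √Real.pi := by
  have h1 := hasDerivAt_besselNorm (-(1 / 2)) x
  rw [funext besselNorm_neg_half] at h1
  have h2 := ((Real.hasDerivAt_cos x).div_const (√Real.pi)).unique h1
  rw [show (-(1 / 2) + 1 : ℝ) = 1 / 2 by norm_num] at h2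
  linarith [neg_div (√Real.pi) (Real.sin x)]

/-! ### Decay of Bessel functions -/

theorem hasDerivAt_besselNorm_zero (x : ℝ) :
    HasDerivAt (besselNorm 0) (-(x / 2 * besselNorm 1 x)) x := by
  simpa [neg_mul] using hasDerivAt_besselNorm 0 x

theorem hasDerivAt_half_mul_besselNorm_one (x : ℝ) :
    HasDerivAt (fun x => x / 2 * besselNorm 1 x) (besselNorm 0 x - besselNorm 1 x / 2) x := by
  refine (((hasDerivAt_id x).div_const 2).mul (hasDerivAt_besselNorm 1 x)).congr_deriv ?_
  have h := besselNorm_recurrence zero_le_one x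
  rw [sub_self] at h
  rw [h]
  simp only [id]
  ring

/-- The squares of `J_0` and `J_1` decay like `1 / x`. -/
theorem exists_mul_sq_add_sq_le : ∃ C : ℝ, ∀ x, 1 ≤ x →
    x * (besselNorm 0 x ^ 2 + (x / 2 * besselNorm 1 x) ^ 2) ≤ C := by
  set p : ℝ → ℝ := besselNorm 0 with hp
  set q : ℝ → ℝ := fun x => x / 2 * besselNorm 1 x with hq
  have dp : ∀ x, HasDerivAt p (-q x) x := hasDerivAt_besselNorm_zero
  have dq : ∀ x, x ≠ 0 → HasDerivAt q (p x - q x / x) x := fun x hx =>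
    (hasDerivAt_half_mul_besselNorm_one x).congr_deriv (by simp only [hp, hq]; field_simp)
  -- The energy x(p² + q²) has derivative p² - q²; subtracting pq leaves only the smaller pq/x.
  set F : ℝ → ℝ := fun x => x * (p x ^ 2 + q x ^ 2) - p x * q x with hF
  have dF : ∀ x, x ≠ 0 → HasDerivAt F (p x * q x / x) x := fun x hx => by
    refine (((hasDerivAt_id x).mul (((dp x).pow 2).add ((dq x hx).pow 2))).sub
      ((dp x).mul (dq x hx))).congr_deriv ?_
    simp only [id, Pi.add_apply, Pi.pow_apply]
    field_simp
    ring
  have low : ∀ x, 1 ≤ x → x * (p x ^ 2 + q x ^ 2) ≤ 2 * F x := fun x hx => by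
    simp only [hF]
    nlinarith [sq_nonneg (p x - q x), sq_nonneg (p x), sq_nonneg (q x)]
  -- As F dominates x|pq|, F' ≤ F/x² holds, and exp(1/x) is the matching integrating factor.
  have anti : AntitoneOn (fun x => F x * Real.exp x⁻¹) (Set.Ici 1) := by
    have dG : ∀ x, x ≠ 0 → HasDerivAt (fun x => F x * Real.exp x⁻¹)
        (p x * q x / x * Real.exp x⁻¹ + F x * (Real.exp x⁻¹ * (-(x ^ 2)⁻¹))) x := fun x hx =>
      (dF x hx).mul (hasDerivAt_inv hx).exp
    refine antitoneOn_of_deriv_nonpos (convex_Ici 1)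
      (fun x hx => (dG x (by linarith [Set.mem_Ici.1 hx])).continuousAt.continuousWithinAt)
      (fun x hx => ?_) (fun x hx => ?_) <;> rw [interior_Ici, Set.mem_Ioi] at hx
    · exact (dG x (by linarith)).differentiableAt.differentiableWithinAt
    · rw [(dG x (by linarith)).deriv]
      have hx0 : 0 < x := by linarith
      have h1 : p x * q x / x - F x * (x ^ 2)⁻¹ ≤ 0 := by
        have : p x * q x / x - F x * (x ^ 2)⁻¹ = (x * (p x * q x) - F x) / x ^ 2 := by
          field_simp
        rw [this]
        refine div_nonpos_of_nonpos_of_nonneg ?_ (by positivity)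
        have := low x hx.le
        nlinarith [sq_nonneg (p x - q x), sq_nonneg (p x), sq_nonneg (q x)]
      nlinarith [Real.exp_pos x⁻¹]
  refine ⟨2 * (F 1 * Real.exp 1⁻¹), fun x hx => (low x hx).trans ?_⟩
  have h := anti (Set.mem_Ici.2 le_rfl) hx hx
  simp only at h
  have hF0 : 0 ≤ F x := by
    have := low x hx
    have : 0 ≤ x * (p x ^ 2 + q x ^ 2) := by positivity
    linarith
  have : F x * 1 ≤ F x * Real.exp x⁻¹ := by
    gcongr
    exact Real.one_le_exp (by positivity)
  linarith

/-- Decay of `J_{d/2}` like `x ^ (-1/2)`, in terms of the normalized Bessel function. -/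
theorem exists_pow_mul_besselNorm_sq_le (d : ℕ) : ∃ C : ℝ, ∀ x, 0 ≤ x →
    x ^ (d + 1) * besselNorm ((d : ℝ) / 2) x ^ 2 ≤ C := by
  -- Orders are indexed as (e - 1)/2 so that the induction can start at -1/2. The recurrence uses
  -- the two preceding orders of the same parity class, hence the four base cases -1/2, 0, 1/2, 1.
  suffices h : ∀ e : ℕ, ∃ C : ℝ, ∀ x, 1 ≤ x → x ^ e * besselNorm (((e : ℝ) - 1) / 2) x ^ 2 ≤ C by
    obtain ⟨C, hC⟩ := h (d + 1)
    rw [Nat.cast_add_one, add_sub_cancel_right] at hC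
    obtain ⟨C', hC'⟩ := (isCompact_Icc (a := (0 : ℝ)) (b := 1)).exists_bound_of_continuousOn
      (f := fun x => x ^ (d + 1) * besselNorm ((d : ℝ) / 2) x ^ 2)
      ((continuous_pow _).mul ((continuous_besselNorm _).pow 2)).continuousOn
    refine ⟨max C C', fun x hx => ?_⟩
    rcases le_total 1 x with h | h
    · exact (hC x h).trans (le_max_left _ _)
    · exact (Real.le_norm_self _).trans ((hC' x ⟨hx, h⟩).trans (le_max_right _ _))
  intro e
  induction e using Nat.strong_induction_on with
  | _ e ih =>
    obtain ⟨C, hC⟩ := exists_mul_sq_add_sq_le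
    match e, ih with
    | 0, _ =>
      refine ⟨1 / Real.pi, fun x _ => ?_⟩
      rw [show (((0 : ℕ) : ℝ) - 1) / 2 = -(1 / 2) by norm_num, besselNorm_neg_half, div_pow,
        Real.sq_sqrt Real.pi_pos.le, pow_zero, one_mul]
      gcongr
      exact Real.cos_sq_le_one x
    | 1, _ =>
      refine ⟨C, fun x hx => (le_trans ?_ (hC x hx))⟩
      simp only [pow_one, Nat.cast_one, sub_self, zero_div]
      gcongr
      nlinarith [sq_nonneg (x / 2 * besselNorm 1 x)]
    | 2, _ =>
      refine ⟨4 / Real.pi, fun x hx => ?_⟩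
      have : x ^ 2 * besselNorm ((((2 : ℕ) : ℝ) - 1) / 2) x ^ 2
          = 4 * (x / 2 * besselNorm (1 / 2) x) ^ 2 := by
        rw [show (((2 : ℕ) : ℝ) - 1) / 2 = 1 / 2 by norm_num]; ring
      rw [this, mul_besselNorm_half, div_pow, Real.sq_sqrt Real.pi_pos.le, mul_div_assoc']
      gcongr
      linarith [Real.sin_sq_le_one x]
    | 3, _ =>
      refine ⟨4 * C, fun x hx => ?_⟩
      have h := hC x hx
      have : x ^ 3 * besselNorm ((((3 : ℕ) : ℝ) - 1) / 2) x ^ 2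
          = 4 * (x * (x / 2 * besselNorm 1 x) ^ 2) := by
        rw [show (((3 : ℕ) : ℝ) - 1) / 2 = 1 by norm_num]; ring
      rw [this]
      nlinarith [mul_nonneg (by linarith : (0 : ℝ) ≤ x) (sq_nonneg (besselNorm 0 x))]
    | e + 4, ih =>
      obtain ⟨C₀, h₀⟩ := ih e (by lia)
      obtain ⟨C₂, h₂⟩ := ih (e + 2) (by lia)
      set a : ℝ := ((e : ℝ) + 1) / 2 with ha
      rw [show (((e + 2 : ℕ) : ℝ) - 1) / 2 = a by push_cast; ring] at h₂
      rw [show ((e : ℝ) - 1) / 2 = a - 1 by ring] at h₀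
      rw [show (((e + 4 : ℕ) : ℝ) - 1) / 2 = a + 1 by push_cast; ring]
      -- 32 = 16 · 2: the 16 clears (x/2)⁴, the 2 comes from (u - v)² ≤ 2(u² + v²).
      refine ⟨32 * (a ^ 2 * C₂ + C₀), fun x hx => ?_⟩
      have hx0 : (0 : ℝ) ≤ x := by linarith
      have hr := besselNorm_recurrence (show 0 ≤ a by positivity) x
      have hA : x ^ e * besselNorm a x ^ 2 ≤ C₂ := by
        refine le_trans ?_ (h₂ x hx)
        gcongr
        lia
      have e1 : x ^ (e + 4) * besselNorm (a + 1) x ^ 2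
          = 16 * (x ^ e * ((x / 2) ^ 2 * besselNorm (a + 1) x) ^ 2) := by ring
      have e2 : (x / 2) ^ 2 * besselNorm (a + 1) x
          = a * besselNorm a x - besselNorm (a - 1) x := by rw [hr]; ring
      rw [e1, e2]
      calc 16 * (x ^ e * (a * besselNorm a x - besselNorm (a - 1) x) ^ 2)
          ≤ 16 * (x ^ e * (2 * ((a * besselNorm a x) ^ 2 + besselNorm (a - 1) x ^ 2))) := by
            gcongr
            nlinarith [sq_nonneg (a * besselNorm a x + besselNorm (a - 1) x)]
        _ = 32 * (a ^ 2 * (x ^ e * besselNorm a x ^ 2) + x ^ e * besselNorm (a - 1) x ^ 2) := by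
            ring
        _ ≤ _ := by
            gcongr
            exact h₀ x hx

theorem tendsto_boundary_term {d : ℕ} {s : ℝ} (hs : 0 < s) :
    Tendsto (fun R : ℝ => (R / 2) ^ d * besselNorm ((d : ℝ) / 2) (s * R) *
      besselNorm ((d : ℝ) / 2) R) atTop (𝓝 0) := by
  obtain ⟨C, hC⟩ := exists_pow_mul_besselNorm_sq_le d
  have h0 : Tendsto (fun R : ℝ => (C / s ^ (d + 1) + C) * R⁻¹) atTop (𝓝 0) := by
    simpa using tendsto_inv_atTop_zero.const_mul (C / s ^ (d + 1) + C)
  refine squeeze_zero_norm' ?_ h0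
  filter_upwards [eventually_gt_atTop 0] with R hR
  set u := besselNorm ((d : ℝ) / 2) (s * R)
  set v := besselNorm ((d : ℝ) / 2) R
  have h1 : R ^ (d + 1) * u ^ 2 ≤ C / s ^ (d + 1) := by
    rw [le_div_iff₀ (by positivity)]
    have := hC (s * R) (by positivity)
    rw [mul_pow] at this
    linarith
  have h2 : R ^ (d + 1) * v ^ 2 ≤ C := hC R hR.le
  have h3 : |u * v| ≤ u ^ 2 + v ^ 2 := by
    rw [abs_le]
    constructor <;> nlinarith [sq_nonneg (u + v), sq_nonneg (u - v), sq_nonneg u, sq_nonneg v]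
  rw [← div_eq_mul_inv, le_div_iff₀ hR, mul_assoc, norm_mul, Real.norm_eq_abs, Real.norm_eq_abs,
    abs_of_pos (by positivity)]
  calc (R / 2) ^ d * |u * v| * R ≤ R ^ d * (u ^ 2 + v ^ 2) * R := by
        gcongr
        linarith
    _ = R ^ (d + 1) * u ^ 2 + R ^ (d + 1) * v ^ 2 := by ring
    _ ≤ _ := add_le_add h1 h2

/-! ### The Dirichlet integral -/

theorem hasDerivAt_integral_of_continuous {F F' : ℝ → ℝ → ℝ} {a b : ℝ}
    (hF : ∀ s, Continuous (F s)) (hF' : Continuous (Function.uncurry F'))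
    (hd : ∀ s t, HasDerivAt (fun s => F s t) (F' s t) s) (s₀ : ℝ) :
    HasDerivAt (fun s => ∫ t in a..b, F s t) (∫ t in a..b, F' s₀ t) s₀ := by
  obtain ⟨M, hM⟩ := ((isCompact_closedBall s₀ 1).prod
    (isCompact_uIcc (a := a) (b := b))).exists_bound_of_continuousOn hF'.continuousOn
  have hc : Continuous (F' s₀) := hF'.comp (by fun_prop : Continuous fun t => (s₀, t))
  refine (intervalIntegral.hasDerivAt_integral_of_dominated_loc_of_deriv_le (F := F) (F' := F')
    (bound := fun _ => M) (Metric.closedBall_mem_nhds s₀ one_pos)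
    (.of_forall fun s => (hF s).aestronglyMeasurable) ((hF s₀).intervalIntegrable _ _)
    hc.aestronglyMeasurable (.of_forall fun t ht s hs => ?_) (by simp)
    (.of_forall fun t _ s _ => hd s t)).2
  exact hM (s, t) ⟨hs, Set.uIoc_subset_uIcc ht⟩

theorem integral_exp_neg_mul_sin (t R : ℝ) : ∫ x in (0 : ℝ)..R, Real.exp (-(t * x)) * Real.sin x
    = (1 - Real.exp (-(t * R)) * (Real.cos R + t * Real.sin R)) / (1 + t ^ 2) := by
  have ht : 1 + t ^ 2 ≠ 0 := by positivity
  have hd : ∀ x ∈ Set.uIcc 0 R, HasDerivAt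
      (fun x => -(Real.exp (-(t * x)) * (Real.cos x + t * Real.sin x)) / (1 + t ^ 2))
      (Real.exp (-(t * x)) * Real.sin x) x := fun x _ => by
    refine ((((((hasDerivAt_id x).const_mul t).neg).exp).mul ((Real.hasDerivAt_cos x).add
      ((Real.hasDerivAt_sin x).const_mul t))).neg.div_const _).congr_deriv ?_
    simp only [id, Pi.neg_apply, Pi.add_apply]
    field_simp
    ring
  rw [intervalIntegral.integral_eq_sub_of_hasDerivAt hd
    ((by fun_prop : Continuous _).intervalIntegrable _ _)]
  simp
  ring

/-- Quantitative form of the Dirichlet integral `∫_0^∞ sin x / x dx = π / 2`. -/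
theorem abs_integral_sinc_sub_le {R : ℝ} (hR : 0 < R) :
    |(∫ x in (0 : ℝ)..R, Real.sinc x) - Real.pi / 2| ≤ 2 / R := by
  -- Laplace regularization: φ(0) is the wanted integral, φ(∞) = 0, and φ' is -1/(1 + t²) up to an
  -- error of size at most 2 exp(-tR).
  set φ : ℝ → ℝ := fun t => ∫ x in (0 : ℝ)..R, Real.exp (-(t * x)) * Real.sinc x with hφ
  have hs := Real.continuous_sinc
  have dφ : ∀ t, HasDerivAt φ
      (-((1 - Real.exp (-(t * R)) * (Real.cos R + t * Real.sin R)) / (1 + t ^ 2))) t := fun t => by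
    rw [← integral_exp_neg_mul_sin, ← intervalIntegral.integral_neg]
    refine hasDerivAt_integral_of_continuous
      (F := fun t x => Real.exp (-(t * x)) * Real.sinc x)
      (F' := fun t x => -(Real.exp (-(t * x)) * Real.sin x)) (fun t => by fun_prop)
      (by unfold Function.uncurry; fun_prop) (fun t x => ?_) t
    refine ((((hasDerivAt_id t).mul_const x).neg).exp.mul_const _).congr_deriv ?_
    rcases eq_or_ne x 0 with rfl | hx
    · simp
    · rw [Real.sinc_of_ne_zero hx]
      simp only [id, Pi.neg_apply]
      field_simp
  have dE : ∀ t, HasDerivAt (fun t => 2 / R * Real.exp (-(t * R))) (-(2 * Real.exp (-(t * R)))) t :=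
    fun t => by
      refine (((((hasDerivAt_id t).mul_const R).neg).exp).const_mul (2 / R)).congr_deriv ?_
      simp only [id, Pi.neg_apply]
      field_simp
  have dA : ∀ t, HasDerivAt (fun t => φ t + Real.arctan t)
      (Real.exp (-(t * R)) * ((Real.cos R + t * Real.sin R) / (1 + t ^ 2))) t := fun t => by
    refine ((dφ t).add (Real.hasDerivAt_arctan t)).congr_deriv ?_
    have ht : 1 + t ^ 2 ≠ 0 := by positivity
    field_simp
    ring
  have hb : ∀ t : ℝ, |(Real.cos R + t * Real.sin R) / (1 + t ^ 2)| ≤ 2 := fun t => by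
    have ht : 0 < 1 + t ^ 2 := by positivity
    rw [abs_div, abs_of_pos ht, div_le_iff₀ ht]
    have h1 : |t * Real.sin R| ≤ |t| := by
      rw [abs_mul]
      exact mul_le_of_le_one_right (abs_nonneg _) (Real.abs_sin_le_one R)
    have h2 := abs_add_le (Real.cos R) (t * Real.sin R)
    have h3 := Real.abs_cos_le_one R
    nlinarith [sq_abs t, sq_nonneg (|t| - 1)]
  have lφ : Tendsto φ atTop (𝓝 0) := by
    refine squeeze_zero_norm' (a := fun t : ℝ => t⁻¹) ?_ tendsto_inv_atTop_zero
    filter_upwards [eventually_gt_atTop 0] with t ht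
    have hI : ∫ x in (0 : ℝ)..R, Real.exp (-(t * x)) = (1 - Real.exp (-(t * R))) / t := by
      have hd : ∀ x ∈ Set.uIcc 0 R, HasDerivAt (fun x => -Real.exp (-(t * x)) / t)
          (Real.exp (-(t * x))) x := fun x _ => by
        refine ((((hasDerivAt_id x).const_mul t).neg.exp).neg.div_const t).congr_deriv ?_
        simp only [id, Pi.neg_apply]
        field_simp
      rw [intervalIntegral.integral_eq_sub_of_hasDerivAt hd
        ((by fun_prop : Continuous _).intervalIntegrable _ _)]
      simp
      ring
    calc ‖φ t‖ ≤ ∫ x in (0 : ℝ)..R, Real.exp (-(t * x)) := by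
          refine intervalIntegral.norm_integral_le_of_norm_le hR.le (.of_forall fun x _ => ?_)
            ((by fun_prop : Continuous _).intervalIntegrable _ _)
          rw [norm_mul, Real.norm_eq_abs, Real.abs_exp]
          exact mul_le_of_le_one_right (Real.exp_pos _).le (Real.abs_sinc_le_one x)
      _ ≤ t⁻¹ := by
          rw [hI, inv_eq_one_div]
          gcongr
          linarith [Real.exp_pos (-(t * R))]
  have lE : Tendsto (fun t => 2 / R * Real.exp (-(t * R))) atTop (𝓝 0) := by
    have : Tendsto (fun t => Real.exp (-(t * R))) atTop (𝓝 0) :=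
      Real.tendsto_exp_neg_atTop_nhds_zero.comp (tendsto_id.atTop_mul_const hR)
    simpa using this.const_mul (2 / R)
  have lA : Tendsto (fun t => φ t + Real.arctan t) atTop (𝓝 (Real.pi / 2)) := by
    simpa using lφ.add (Real.tendsto_arctan_atTop.mono_right nhdsWithin_le_nhds)
  have h0 : φ 0 = ∫ x in (0 : ℝ)..R, Real.sinc x := by simp [hφ]
  -- Adding or subtracting an antiderivative of the error bound makes φ + arctan monotone; comparing
  -- t = 0 with t → ∞ gives both inequalities.
  have up : Antitone fun t => φ t + Real.arctan t + 2 / R * Real.exp (-(t * R)) := by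
    refine antitone_of_deriv_nonpos (fun t => ((dA t).add (dE t)).differentiableAt) fun t => ?_
    have hD : HasDerivAt (fun t => φ t + Real.arctan t + 2 / R * Real.exp (-(t * R))) _ t :=
      (dA t).add (dE t)
    rw [hD.deriv]
    nlinarith [(abs_le.1 (hb t)).2, Real.exp_pos (-(t * R))]
  have lo : Monotone fun t => φ t + Real.arctan t - 2 / R * Real.exp (-(t * R)) := by
    refine monotone_of_deriv_nonneg (fun t => ((dA t).sub (dE t)).differentiableAt) fun t => ?_
    have hD : HasDerivAt (fun t => φ t + Real.arctan t - 2 / R * Real.exp (-(t * R))) _ t :=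
      (dA t).sub (dE t)
    rw [hD.deriv]
    nlinarith [(abs_le.1 (hb t)).1, Real.exp_pos (-(t * R))]
  have b1 := up.le_of_tendsto (lA.add lE) 0
  have b2 := lo.ge_of_tendsto (lA.sub lE) 0
  simp only [h0, Real.arctan_zero, zero_mul, neg_zero, Real.exp_zero] at b1 b2
  rw [abs_le]
  constructor <;> linarith

theorem tendsto_integral_sinc :
    Tendsto (fun R : ℝ => ∫ x in (0 : ℝ)..R, Real.sinc x) atTop (𝓝 (Real.pi / 2)) := by
  rw [tendsto_iff_norm_sub_tendsto_zero]
  refine squeeze_zero' (g := fun R : ℝ => 2 / R) (.of_forall fun R => norm_nonneg _) ?_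
    (tendsto_const_nhds.div_atTop tendsto_id)
  filter_upwards [eventually_gt_atTop 0] with R hR
  exact abs_integral_sinc_sub_le hR

/-- Used with c = 1 + s and c = 1 - s; the sign of the latter is the jump of the cut-off. -/
theorem tendsto_integral_sinc_mul (c : ℝ) :
    Tendsto (fun R : ℝ => ∫ x in (0 : ℝ)..c * R, Real.sinc x) atTop
      (𝓝 (SignType.sign c * (Real.pi / 2))) := by
  rcases lt_trichotomy c 0 with hc | rfl | hc
  · have h : ∀ R : ℝ, ∫ x in (0 : ℝ)..c * R, Real.sinc x
        = -∫ x in (0 : ℝ)..(-c) * R, Real.sinc x := fun R => by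
      have := intervalIntegral.integral_comp_neg (a := 0) (b := (-c) * R) Real.sinc
      simp only [Real.sinc_neg] at this
      rw [this, neg_zero, neg_mul, neg_neg, intervalIntegral.integral_symm]
    simp only [h, sign_neg hc, SignType.coe_neg_one, neg_one_mul]
    exact (tendsto_integral_sinc.comp (tendsto_id.const_mul_atTop (neg_pos.2 hc))).neg
  · simp
  · simp only [sign_pos hc, SignType.coe_one, one_mul]
    exact tendsto_integral_sinc.comp (tendsto_id.const_mul_atTop hc)

/-! ### The radial integral in dimension one -/

/-- The radial Fourier integral of the normalized Bessel function `J_{d/2}(ρ) / ρ^{d/2}`. -/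
noncomputable def radialIntegral (d : ℕ) (s R : ℝ) : ℝ :=
  ∫ ρ in (0 : ℝ)..R, (ρ / 2) ^ (d - 1) *
    (besselNorm ((d : ℝ) / 2) ρ * besselNorm ((d : ℝ) / 2 - 1) (s * ρ))

theorem continuous_radialIntegrand (d : ℕ) (s : ℝ) : Continuous fun ρ : ℝ => (ρ / 2) ^ (d - 1) *
    (besselNorm ((d : ℝ) / 2) ρ * besselNorm ((d : ℝ) / 2 - 1) (s * ρ)) := by
  have h1 := continuous_besselNorm ((d : ℝ) / 2)
  have h2 := continuous_besselNorm ((d : ℝ) / 2 - 1)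
  fun_prop

theorem besselNorm_half (x : ℝ) : besselNorm (1 / 2) x = 2 * Real.sinc x / √Real.pi := by
  rcases eq_or_ne x 0 with rfl | hx
  · have : (1 / 2 : ℝ) + 1 = ((1 : ℕ) : ℝ) + 1 / 2 := by norm_num
    rw [besselNorm_zero_right, this, Gamma_natCast_add_half]
    simp
    field_simp
    norm_num
  · have h := mul_besselNorm_half x
    rw [Real.sinc_of_ne_zero hx]
    have : √Real.pi ≠ 0 := by positivity
    field_simp at h ⊢
    linarith

/-- From 2 sin ρ cos(sρ) = sin((1 + s)ρ) + sin((1 - s)ρ), each term then rescaled. -/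
theorem radialIntegral_one (s R : ℝ) : radialIntegral 1 s R = Real.pi⁻¹ *
    ((∫ x in (0 : ℝ)..(1 + s) * R, Real.sinc x) + ∫ x in (0 : ℝ)..(1 - s) * R, Real.sinc x) := by
  have hs := Real.continuous_sinc
  have h : ∀ c : ℝ, ∫ x in (0 : ℝ)..c * R, Real.sinc x
      = ∫ x in (0 : ℝ)..R, c * Real.sinc (c * x) := fun c => by
    rw [intervalIntegral.integral_const_mul, intervalIntegral.mul_integral_comp_mul_left, mul_zero]
  have hk : ∀ c x : ℝ, x ≠ 0 → c * Real.sinc (c * x) = Real.sin (c * x) / x := fun c x hx => by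
    rcases eq_or_ne c 0 with rfl | hc
    · simp
    · rw [Real.sinc_of_ne_zero (mul_ne_zero hc hx)]
      field_simp
  rw [h, h, ← intervalIntegral.integral_add ((by fun_prop : Continuous _).intervalIntegrable _ _)
    ((by fun_prop : Continuous _).intervalIntegrable _ _), ← intervalIntegral.integral_const_mul,
    radialIntegral]
  refine intervalIntegral.integral_congr fun ρ _ => ?_
  simp only [Nat.cast_one, tsub_self, pow_zero, one_mul]
  rw [show (1 / 2 - 1 : ℝ) = -(1 / 2) by norm_num, besselNorm_half, besselNorm_neg_half,
    div_mul_div_comm, Real.mul_self_sqrt Real.pi_pos.le]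
  rcases eq_or_ne ρ 0 with rfl | hρ
  · simp
    ring
  · rw [hk _ _ hρ, hk _ _ hρ, Real.sinc_of_ne_zero hρ, add_mul, sub_mul, Real.sin_add, Real.sin_sub,
      one_mul]
    ring

theorem tendsto_radialIntegral_one {s : ℝ} (hs : 0 < s) :
    Tendsto (radialIntegral 1 s) atTop (𝓝 (cutoff 1 s)) := by
  have h := ((tendsto_integral_sinc_mul (1 + s)).add
    (tendsto_integral_sinc_mul (1 - s))).const_mul Real.pi⁻¹
  refine (h.congr fun R => (radialIntegral_one s R).symm).trans (le_of_eq ?_)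
  congr 1
  have hπ := Real.pi_ne_zero
  rw [sign_pos (by linarith : 0 < 1 + s), cutoff]
  rcases lt_trichotomy s 1 with h | rfl | h
  · rw [if_pos h, sign_pos (by linarith)]
    simp
  · simp
    field_simp
  · rw [if_neg h.not_gt, if_neg h.ne', sign_neg (by linarith)]
    simp

/-! ### Raising the dimension by two -/

theorem hasDerivAt_pow_mul_besselNorm (d : ℕ) (s ρ : ℝ) :
    HasDerivAt (fun ρ => (ρ / 2) ^ (d + 1) * besselNorm (((d + 1 : ℕ) : ℝ) / 2) (s * ρ))
      ((ρ / 2) ^ d * besselNorm (((d + 1 : ℕ) : ℝ) / 2 - 1) (s * ρ)) ρ := by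
  have h1 := (hasDerivAt_besselNorm (((d + 1 : ℕ) : ℝ) / 2) (s * ρ)).comp ρ
    ((hasDerivAt_id ρ).const_mul s)
  refine ((((hasDerivAt_id ρ).div_const 2).pow (d + 1)).mul h1).congr_deriv ?_
  rw [besselNorm_recurrence (by positivity)]
  simp only [id, Function.comp, Nat.add_sub_cancel, Pi.pow_apply]
  push_cast
  ring

/-- Integration by parts: differentiating (ρ/2)^d N_{d/2}(sρ) lowers one order, differentiating
N_{d/2}(ρ) raises the other. The boundary term at 0 vanishes because d > 0. -/
theorem radialIntegral_add_two {d : ℕ} (hd : 0 < d) (s R : ℝ) :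
    radialIntegral (d + 2) s R = radialIntegral d s R -
      (R / 2) ^ d * besselNorm ((d : ℝ) / 2) (s * R) * besselNorm ((d : ℝ) / 2) R := by
  obtain ⟨d, rfl⟩ := Nat.exists_eq_add_of_lt hd
  rw [zero_add]
  have e1 : ((d + 1 + 2 : ℕ) : ℝ) / 2 = ((d + 1 : ℕ) : ℝ) / 2 + 1 := by push_cast; ring
  have hc := continuous_radialIntegrand (d + 1) s
  have hc2 := continuous_radialIntegrand (d + 1 + 2) s
  have hd : ∀ ρ ∈ Set.uIcc 0 R, HasDerivAt (fun ρ => (ρ / 2) ^ (d + 1) *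
      besselNorm (((d + 1 : ℕ) : ℝ) / 2) (s * ρ) * besselNorm (((d + 1 : ℕ) : ℝ) / 2) ρ)
      ((ρ / 2) ^ (d + 1 - 1) * (besselNorm (((d + 1 : ℕ) : ℝ) / 2) ρ *
        besselNorm (((d + 1 : ℕ) : ℝ) / 2 - 1) (s * ρ)) - (ρ / 2) ^ (d + 1 + 2 - 1) *
        (besselNorm (((d + 1 + 2 : ℕ) : ℝ) / 2) ρ *
          besselNorm (((d + 1 + 2 : ℕ) : ℝ) / 2 - 1) (s * ρ))) ρ := fun ρ _ => by
    refine ((hasDerivAt_pow_mul_besselNorm d s ρ).mul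
      (hasDerivAt_besselNorm (((d + 1 : ℕ) : ℝ) / 2) ρ)).congr_deriv ?_
    rw [e1, add_sub_cancel_right, Nat.add_sub_cancel, show d + 1 + 2 - 1 = d + 2 by lia]
    ring
  have h := intervalIntegral.integral_eq_sub_of_hasDerivAt hd
    ((hc.sub hc2).intervalIntegrable _ _)
  rw [intervalIntegral.integral_sub (hc.intervalIntegrable _ _) (hc2.intervalIntegrable _ _)] at h
  simp only [zero_div, ne_eq, Nat.add_eq_zero_iff, one_ne_zero, and_false, not_false_eq_true,
    zero_pow, zero_mul, sub_zero] at h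
  rw [← h, radialIntegral, radialIntegral]
  ring

/-! ### The radial integral in dimension two -/

theorem radialIntegral_two (s R : ℝ) :
    radialIntegral 2 s R = ∫ ρ in (0 : ℝ)..R, ρ / 2 * (besselNorm 1 ρ * besselNorm 0 (s * ρ)) := by
  simp [radialIntegral]

theorem hasDerivAt_besselNorm_zero_mul (s ρ : ℝ) :
    HasDerivAt (fun ρ => besselNorm 0 (s * ρ)) (-(s * (s * ρ / 2 * besselNorm 1 (s * ρ)))) ρ := by
  refine ((hasDerivAt_besselNorm_zero (s * ρ)).comp ρ
    ((hasDerivAt_id ρ).const_mul s)).congr_deriv ?_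
  ring

/-- The defect in the relation between `∫ J_1(ρ) J_0(sρ)` and `∫ J_1(ρ) J_1(sρ) / ρ`. -/
noncomputable def besselDefect (s R : ℝ) : ℝ :=
  besselNorm 0 R * besselNorm 0 (s * R) +
    s * (R / 2 * besselNorm 1 R * (s * R / 2 * besselNorm 1 (s * R)))

/-- The function `1 - 2 s ∫_0^R J_1(ρ) J_1(sρ) / ρ dρ` of `s`. -/
noncomputable def besselProductIntegral (s R : ℝ) : ℝ :=
  1 - 2 * ∫ ρ in (0 : ℝ)..R, s ^ 2 * ρ / 4 * (besselNorm 1 ρ * besselNorm 1 (s * ρ))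

/-- The defect is 1 at R = 0, and its R-derivative combines the integrands of the two integrals. -/
theorem one_sub_sq_mul_radialIntegral_two (s R : ℝ) :
    (1 - s ^ 2) * radialIntegral 2 s R = besselProductIntegral s R - besselDefect s R := by
  have c0 := continuous_besselNorm 0
  have c1 := continuous_besselNorm 1
  have hd : ∀ ρ ∈ Set.uIcc 0 R, HasDerivAt (besselDefect s)
      (-((1 - s ^ 2) * (ρ / 2 * (besselNorm 1 ρ * besselNorm 0 (s * ρ))) +
        2 * (s ^ 2 * ρ / 4 * (besselNorm 1 ρ * besselNorm 1 (s * ρ))))) ρ := fun ρ _ => by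
    have hq : HasDerivAt (fun ρ => s * ρ / 2 * besselNorm 1 (s * ρ))
        ((besselNorm 0 (s * ρ) - besselNorm 1 (s * ρ) / 2) * s) ρ :=
      ((hasDerivAt_half_mul_besselNorm_one (s * ρ)).comp ρ
        ((hasDerivAt_id ρ).const_mul s)).congr_deriv (by ring)
    refine (((hasDerivAt_besselNorm_zero ρ).mul (hasDerivAt_besselNorm_zero_mul s ρ)).add
      (((hasDerivAt_half_mul_besselNorm_one ρ).mul hq).const_mul s)).congr_deriv ?_
    ring
  have h := intervalIntegral.integral_eq_sub_of_hasDerivAt hd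
    ((by fun_prop : Continuous _).intervalIntegrable _ _)
  rw [intervalIntegral.integral_neg, intervalIntegral.integral_add
    ((by fun_prop : Continuous _).intervalIntegrable _ _)
    ((by fun_prop : Continuous _).intervalIntegrable _ _), intervalIntegral.integral_const_mul,
    intervalIntegral.integral_const_mul, ← radialIntegral_two] at h
  have h0 : besselDefect s 0 = 1 := by
    simp [besselDefect, besselNorm_zero_right]
  rw [h0] at h
  rw [besselProductIntegral]
  linarith

/-- The s-derivative of s J_1(sρ) is sρ J_0(sρ); the ρ cancels the weight 1/ρ and the radial
integral reappears. -/
theorem hasDerivAt_besselProductIntegral (s R : ℝ) :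
    HasDerivAt (fun s => besselProductIntegral s R) (-(2 * s * radialIntegral 2 s R)) s := by
  have c0 := continuous_besselNorm 0
  have c1 := continuous_besselNorm 1
  have h := hasDerivAt_integral_of_continuous (a := 0) (b := R)
    (F := fun s ρ => s ^ 2 * ρ / 4 * (besselNorm 1 ρ * besselNorm 1 (s * ρ)))
    (F' := fun s ρ => s * (ρ / 2 * (besselNorm 1 ρ * besselNorm 0 (s * ρ))))
    (fun s => by fun_prop) (by unfold Function.uncurry; fun_prop) (fun s ρ => by
      have h1 := (hasDerivAt_besselNorm 1 (s * ρ)).comp s ((hasDerivAt_id s).mul_const ρ)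
      refine (((((hasDerivAt_id s).pow 2).mul_const ρ).div_const 4).mul
        (h1.const_mul (besselNorm 1 ρ))).congr_deriv ?_
      have hr := besselNorm_recurrence zero_le_one (s * ρ)
      rw [sub_self] at hr
      rw [hr]
      simp only [id, Function.comp, Pi.pow_apply]
      push_cast
      ring) s
  refine ((h.const_mul 2).const_sub 1).congr_deriv ?_
  rw [intervalIntegral.integral_const_mul, ← radialIntegral_two]
  ring

theorem exists_abs_besselNorm_le : ∃ M : ℝ, ∀ x, 0 ≤ x →
    |besselNorm 0 x| ≤ M ∧ |x / 2 * besselNorm 1 x| ≤ M := by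
  obtain ⟨C, hC⟩ := exists_mul_sq_add_sq_le
  have c0 := continuous_besselNorm 0
  have c1 := continuous_besselNorm 1
  obtain ⟨A, hA⟩ := (isCompact_Icc (a := (0 : ℝ)) (b := 1)).exists_bound_of_continuousOn
    c0.continuousOn
  obtain ⟨B, hB⟩ := (isCompact_Icc (a := (0 : ℝ)) (b := 1)).exists_bound_of_continuousOn
    (by fun_prop : Continuous fun x => x / 2 * besselNorm 1 x).continuousOn
  refine ⟨max (√C) (max A B), fun x hx => ?_⟩
  rcases le_total x 1 with h | h
  · exact ⟨le_max_of_le_right (le_max_of_le_left (hA x ⟨hx, h⟩)),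
      le_max_of_le_right (le_max_of_le_right (hB x ⟨hx, h⟩))⟩
  · have h1 := hC x h
    have h2 : besselNorm 0 x ^ 2 + (x / 2 * besselNorm 1 x) ^ 2 ≤ C := by
      nlinarith [sq_nonneg (besselNorm 0 x), sq_nonneg (x / 2 * besselNorm 1 x)]
    exact ⟨le_max_of_le_left (Real.abs_le_sqrt (by nlinarith [sq_nonneg (x / 2 * besselNorm 1 x)])),
      le_max_of_le_left (Real.abs_le_sqrt (by nlinarith [sq_nonneg (besselNorm 0 x)]))⟩

theorem tendsto_besselNorm_zero_atTop : Tendsto (besselNorm 0) atTop (𝓝 0) ∧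
    Tendsto (fun x => x / 2 * besselNorm 1 x) atTop (𝓝 0) := by
  obtain ⟨C, hC⟩ := exists_mul_sq_add_sq_le
  have hl : Tendsto (fun x : ℝ => √(C / x)) atTop (𝓝 0) := by
    simpa only [Real.sqrt_zero] using
      (tendsto_const_nhds.div_atTop (tendsto_id (α := ℝ)) : Tendsto (fun x => C / x) _ _).sqrt
  have hb : ∀ x, 1 ≤ x → besselNorm 0 x ^ 2 + (x / 2 * besselNorm 1 x) ^ 2 ≤ C / x :=
    fun x hx => by
      rw [le_div_iff₀ (by linarith), mul_comm]
      exact hC x hx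
  constructor <;> refine squeeze_zero_norm' ?_ hl <;>
    filter_upwards [eventually_ge_atTop 1] with x hx <;>
    refine Real.abs_le_sqrt ?_
  · nlinarith [hb x hx, sq_nonneg (x / 2 * besselNorm 1 x)]
  · nlinarith [hb x hx, sq_nonneg (besselNorm 0 x)]

/-- With P the product integral and D the defect, eliminating the radial integral gives d/dt [P/(1 -
t²)] = 2tD/(1 - t²)². Since P = 1 at t = 0 and D → 0 uniformly on [0, s], P/(1 - s²) → 1 by the mean
value inequality. -/
theorem tendsto_radialIntegral_two_of_lt_one {s : ℝ} (hs : 0 < s) (hs1 : s < 1) :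
    Tendsto (radialIntegral 2 s) atTop (𝓝 1) := by
  obtain ⟨M, hM⟩ := exists_abs_besselNorm_le
  have hM0 : 0 ≤ M := (abs_nonneg _).trans (hM 0 le_rfl).1
  obtain ⟨l0, l1⟩ := tendsto_besselNorm_zero_atTop
  set δ : ℝ → ℝ := fun R => (|besselNorm 0 R| + |R / 2 * besselNorm 1 R|) * M with hδ
  have lδ : Tendsto δ atTop (𝓝 0) := by
    simpa only [abs_zero, add_zero, zero_mul] using (l0.abs.add l1.abs).mul_const M
  -- Uniformity in t comes from the factors at R alone; those at tR are only bounded, as t may be 0.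
  have hdef : ∀ R, 0 ≤ R → ∀ t ∈ Set.Icc 0 s, |besselDefect t R| ≤ δ R := fun R hR t ht => by
    obtain ⟨h0, h1⟩ := hM (t * R) (mul_nonneg ht.1 hR)
    have ht1 : t ≤ 1 := ht.2.trans hs1.le
    refine (abs_add_le _ _).trans ?_
    simp only [hδ]
    rw [add_mul, abs_mul, abs_mul t, abs_mul (R / 2 * _), abs_of_nonneg ht.1]
    have : t * (|R / 2 * besselNorm 1 R| * |t * R / 2 * besselNorm 1 (t * R)|)
        ≤ 1 * (|R / 2 * besselNorm 1 R| * M) := by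
      gcongr
    rw [one_mul] at this
    gcongr
  have hpos : ∀ t ∈ Set.Icc 0 s, 1 - s ^ 2 ≤ 1 - t ^ 2 := fun t ht => by
    nlinarith [ht.1, ht.2]
  have hs2 : 0 < 1 - s ^ 2 := by nlinarith
  have hquot : ∀ R, 0 ≤ R → |besselProductIntegral s R / (1 - s ^ 2) - 1|
      ≤ 2 * δ R / (1 - s ^ 2) ^ 2 := fun R hR => by
    have hd : ∀ t ∈ Set.Icc 0 s, HasDerivWithinAt
        (fun t => besselProductIntegral t R / (1 - t ^ 2))
        (2 * t * besselDefect t R / (1 - t ^ 2) ^ 2) (Set.Icc 0 s) t := fun t ht => by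
      have hne : 1 - t ^ 2 ≠ 0 := (hs2.trans_le (hpos t ht)).ne'
      refine (((hasDerivAt_besselProductIntegral t R).div ((hasDerivAt_pow 2 t).const_sub 1)
        hne).congr_deriv ?_).hasDerivWithinAt
      have := one_sub_sq_mul_radialIntegral_two t R
      congr 1
      push_cast
      linear_combination (-(2 * t)) * this
    have h := (convex_Icc 0 s).norm_image_sub_le_of_norm_hasDerivWithin_le
      (C := 2 * δ R / (1 - s ^ 2) ^ 2) hd (fun t ht => ?_) (Set.left_mem_Icc.2 hs.le)
      (Set.right_mem_Icc.2 hs.le)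
    · have h0 : besselProductIntegral 0 R = 1 := by simp [besselProductIntegral]
      simp only [h0, Real.norm_eq_abs, sub_zero, ne_eq, OfNat.ofNat_ne_zero, not_false_eq_true,
        zero_pow, div_one, abs_of_pos hs] at h
      refine h.trans (mul_le_of_le_one_right ?_ hs1.le)
      positivity
    · have hp := hpos t ht
      rw [norm_div, norm_mul, norm_mul, norm_pow, Real.norm_eq_abs, Real.norm_eq_abs,
        Real.norm_eq_abs, Real.norm_eq_abs, abs_of_pos (hs2.trans_le hp), abs_of_nonneg ht.1,
        abs_two]
      have h1 := hdef R hR t ht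
      have h2 : 2 * t * |besselDefect t R| ≤ 2 * δ R := by
        nlinarith [abs_nonneg (besselDefect t R), ht.1, ht.2]
      have h3 : 0 ≤ 2 * δ R := by positivity
      gcongr
  have lq : Tendsto (fun R => besselProductIntegral s R / (1 - s ^ 2)) atTop (𝓝 1) := by
    rw [tendsto_iff_norm_sub_tendsto_zero]
    refine squeeze_zero' (g := fun R => 2 * δ R / (1 - s ^ 2) ^ 2)
      (.of_forall fun _ => norm_nonneg _) ?_ (by simpa using (lδ.const_mul 2).div_const _)
    filter_upwards [eventually_ge_atTop 0] with R hR using hquot R hR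
  have ld : Tendsto (fun R => besselDefect s R / (1 - s ^ 2)) atTop (𝓝 0) := by
    refine squeeze_zero_norm' (a := fun R => δ R / (1 - s ^ 2)) ?_
      (by simpa using lδ.div_const (1 - s ^ 2))
    filter_upwards [eventually_ge_atTop 0] with R hR
    rw [norm_div, Real.norm_eq_abs, Real.norm_eq_abs, abs_of_pos hs2]
    gcongr
    exact hdef R hR s (Set.right_mem_Icc.2 hs.le)
  have := lq.sub ld
  rw [sub_zero] at this
  refine this.congr fun R => ?_
  rw [← sub_div, ← one_sub_sq_mul_radialIntegral_two, mul_div_cancel_left₀ _ hs2.ne']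

/-- Integrate the derivative of J_0(ρ) J_0(sρ) and rescale one half by s. This gives the value 1/2
at s = 1 and carries s < 1 to s > 1. -/
theorem radialIntegral_two_add_inv {s : ℝ} (hs : 0 < s) (R : ℝ) :
    radialIntegral 2 s R + radialIntegral 2 s⁻¹ (s * R) =
      1 - besselNorm 0 R * besselNorm 0 (s * R) := by
  have c0 := continuous_besselNorm 0
  have c1 := continuous_besselNorm 1
  have hd : ∀ ρ ∈ Set.uIcc 0 R, HasDerivAt (fun ρ => besselNorm 0 ρ * besselNorm 0 (s * ρ))
      (-(ρ / 2 * (besselNorm 1 ρ * besselNorm 0 (s * ρ)) +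
        s * (s * ρ / 2 * (besselNorm 1 (s * ρ) * besselNorm 0 (s⁻¹ * (s * ρ)))))) ρ :=
    fun ρ _ => by
      refine ((hasDerivAt_besselNorm_zero ρ).mul
        (hasDerivAt_besselNorm_zero_mul s ρ)).congr_deriv ?_
      rw [inv_mul_cancel_left₀ hs.ne']
      ring
  have h := intervalIntegral.integral_eq_sub_of_hasDerivAt hd
    ((by fun_prop : Continuous _).intervalIntegrable _ _)
  rw [intervalIntegral.integral_neg, intervalIntegral.integral_add
    ((by fun_prop : Continuous _).intervalIntegrable _ _)
    ((by fun_prop : Continuous _).intervalIntegrable _ _), intervalIntegral.integral_const_mul,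
    ← radialIntegral_two, intervalIntegral.mul_integral_comp_mul_left
      (f := fun x => x / 2 * (besselNorm 1 x * besselNorm 0 (s⁻¹ * x))), mul_zero,
    ← radialIntegral_two] at h
  simp only [besselNorm_zero_right, zero_add, Real.Gamma_one] at h
  linarith

theorem tendsto_radialIntegral_two {s : ℝ} (hs : 0 < s) :
    Tendsto (radialIntegral 2 s) atTop (𝓝 (cutoff 1 s)) := by
  have l0 := tendsto_besselNorm_zero_atTop.1
  have lb : Tendsto (fun R => 1 - besselNorm 0 R * besselNorm 0 (s * R)) atTop (𝓝 1) := by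
    simpa using (l0.mul (l0.comp (tendsto_id.const_mul_atTop hs))).const_sub 1
  rw [cutoff]
  rcases lt_trichotomy s 1 with h | rfl | h
  · rw [if_pos h]
    exact tendsto_radialIntegral_two_of_lt_one hs h
  · rw [if_neg (lt_irrefl _), if_pos rfl]
    refine (lb.div_const 2).congr fun R => ?_
    rw [← radialIntegral_two_add_inv hs, inv_one, one_mul]
    ring
  · rw [if_neg h.not_gt, if_neg h.ne']
    have := lb.sub ((tendsto_radialIntegral_two_of_lt_one (inv_pos.2 hs)
      (inv_lt_one_of_one_lt₀ h)).comp (tendsto_id.const_mul_atTop hs))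
    rw [sub_self] at this
    refine this.congr fun R => ?_
    rw [← radialIntegral_two_add_inv hs]
    simp

theorem tendsto_radialIntegral {d : ℕ} (hd : 0 < d) {s : ℝ} (hs : 0 < s) :
    Tendsto (radialIntegral d s) atTop (𝓝 (cutoff 1 s)) := by
  induction d using Nat.strong_induction_on with
  | _ d ih =>
    match d, hd, ih with
    | 1, _, _ => exact tendsto_radialIntegral_one hs
    | 2, _, _ => exact tendsto_radialIntegral_two hs
    | d + 3, _, ih =>
      have := (ih (d + 1) (by lia) (by lia)).sub (tendsto_boundary_term (d := d + 1) hs)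
      rw [sub_zero] at this
      exact this.congr fun R => (radialIntegral_add_two (d := d + 1) (by lia) s R).symm

/-! ### Polar coordinates -/

theorem integral_volumeIoiPow {F : Type*} [NormedAddCommGroup F] [NormedSpace ℝ F] (n : ℕ)
    (f : ℝ → F) : ∫ r : Set.Ioi (0 : ℝ), f r ∂Measure.volumeIoiPow n =
      ∫ r in Set.Ioi (0 : ℝ), r ^ n • f r := by
  simp only [Measure.volumeIoiPow, ENNReal.ofReal]
  rw [integral_withDensity_eq_integral_smul,
    integral_subtype_comap measurableSet_Ioi fun a ↦ Real.toNNReal (a ^ n) • f a,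
    setIntegral_congr_fun measurableSet_Ioi fun x hx ↦ ?_]
  · rw [NNReal.smul_def, Real.coe_toNNReal _ (pow_nonneg hx.out.le _)]
  · exact (measurable_subtype_coe.pow_const _).real_toNNReal

section Polar

variable {E F : Type*} [NormedAddCommGroup E] [NormedSpace ℝ E] [MeasurableSpace E] [BorelSpace E]
  [FiniteDimensional ℝ E] [NormedAddCommGroup F] (μ : Measure E) [μ.IsAddHaarMeasure]

/-- Integration in polar coordinates. -/
theorem integral_polar [Nontrivial E] [NormedSpace ℝ F] (g : E → F) : ∫ x, g x ∂μ = ∫ p : Metric.sphere (0 : E) 1 × Set.Ioi (0 : ℝ),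
    g (p.2.1 • p.1.1) ∂μ.toSphere.prod (.volumeIoiPow (Module.finrank ℝ E - 1)) := by
  have h := μ.measurePreserving_homeomorphUnitSphereProd.integral_comp
    (Homeomorph.measurableEmbedding _)
    (fun p : Metric.sphere (0 : E) 1 × Set.Ioi (0 : ℝ) => g (p.2.1 • p.1.1))
  have h0 : ∫ x, g x ∂μ = ∫ x : ({0}ᶜ : Set E), g x.1 ∂(μ.comap (↑)) := by
    rw [integral_subtype_comap (measurableSet_singleton _).compl g, restrict_compl_singleton]
  rw [← h, h0]
  refine integral_congr_ae (.of_forall fun x => ?_)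
  have := congrArg Subtype.val ((homeomorphUnitSphereProd E).symm_apply_apply x)
  rw [homeomorphUnitSphereProd_symm_apply_coe] at this
  simp only [this]

theorem integrable_polar {g : E → F} (hg : Integrable g μ) :
    Integrable (fun p : Metric.sphere (0 : E) 1 × Set.Ioi (0 : ℝ) => g (p.2.1 • p.1.1))
      (μ.toSphere.prod (.volumeIoiPow (Module.finrank ℝ E - 1))) := by
  rw [← μ.measurePreserving_homeomorphUnitSphereProd.integrable_comp_emb
    (Homeomorph.measurableEmbedding _)]
  have h : Integrable (fun x : ({0}ᶜ : Set E) => g x) (μ.comap (↑)) := by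
    have := (integrableOn_iff_comap_subtypeVal (μ := μ) (f := g) (s := {0}ᶜ)
      (measurableSet_singleton _).compl).1 hg.integrableOn
    exact this
  refine h.congr (.of_forall fun x => ?_)
  have := congrArg Subtype.val ((homeomorphUnitSphereProd E).symm_apply_apply x)
  rw [homeomorphUnitSphereProd_symm_apply_coe] at this
  simp only [Function.comp, this]

end Polar

/-! ### Gaussian moments and the Fourier transform of the sphere -/

theorem integral_pow_mul_exp_neg_sq_Ioi (n : ℕ) :
    ∫ x in Set.Ioi (0 : ℝ), x ^ n * Real.exp (-x ^ 2) = 1 / 2 * Real.Gamma (((n : ℝ) + 1) / 2) := by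
  rw [← integral_rpow_mul_exp_neg_rpow two_pos (q := n) (by linarith [n.cast_nonneg (α := ℝ)])]
  simp

theorem integral_even_pow_mul_exp_neg_sq (m : ℕ) :
    ∫ x : ℝ, x ^ (2 * m) * Real.exp (-x ^ 2) = Real.Gamma (m + 1 / 2) := by
  have h := integral_comp_abs (f := fun x : ℝ => x ^ (2 * m) * Real.exp (-x ^ 2))
  simp only [pow_mul, sq_abs] at h ⊢
  rw [h]
  simp only [← pow_mul]
  rw [integral_pow_mul_exp_neg_sq_Ioi]
  push_cast
  rw [show (2 * (m : ℝ) + 1) / 2 = m + 1 / 2 by ring]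
  ring

/-- Even moments of the Gaussian in a coordinate direction. -/
theorem integral_coord_pow_mul_exp_neg_norm_sq (n m : ℕ) :
    ∫ x : EuclideanSpace ℝ (Fin (n + 1)), x 0 ^ (2 * m) * Real.exp (-‖x‖ ^ 2) =
      Real.Gamma (m + 1 / 2) * √Real.pi ^ n := by
  rw [← (PiLp.volume_preserving_toLp (Fin (n + 1))).integral_comp
    (MeasurableEquiv.toLp 2 _).measurableEmbedding]
  have h : ∀ x : Fin (n + 1) → ℝ, (WithLp.toLp 2 x : EuclideanSpace ℝ (Fin (n + 1))) 0 ^ (2 * m) *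
      Real.exp (-‖(WithLp.toLp 2 x : EuclideanSpace ℝ (Fin (n + 1)))‖ ^ 2) =
      ∏ i, ((if i = 0 then x i ^ (2 * m) else 1) * Real.exp (-x i ^ 2)) := fun x => by
    rw [Finset.prod_mul_distrib, Finset.prod_ite_eq' Finset.univ 0, if_pos (Finset.mem_univ _),
      ← Real.exp_sum, EuclideanSpace.norm_sq_eq]
    simp
  simp only [h]
  rw [integral_fintype_prod_volume_eq_prod (fun (i : Fin (n + 1)) (y : ℝ) =>
    (if i = 0 then y ^ (2 * m) else 1) * Real.exp (-y ^ 2)), Fin.prod_univ_succ]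
  have hg : ∫ x : ℝ, Real.exp (-x ^ 2) = √Real.pi := by simpa using integral_gaussian 1
  simp [Fin.succ_ne_zero, integral_even_pow_mul_exp_neg_sq, hg]

/-- Even moments of the Gaussian in an arbitrary direction. -/
theorem integral_inner_pow_mul_exp_neg_norm_sq (n m : ℕ) (k : EuclideanSpace ℝ (Fin (n + 1))) :
    ∫ x : EuclideanSpace ℝ (Fin (n + 1)), Real.exp (-‖x‖ ^ 2) * (inner ℝ k x : ℝ) ^ (2 * m) =
      ‖k‖ ^ (2 * m) * (Real.Gamma (m + 1 / 2) * √Real.pi ^ n) := by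
  set w : EuclideanSpace ℝ (Fin (n + 1)) := EuclideanSpace.single 0 ‖k‖ with hw
  have hnorm : ‖w‖ = ‖k‖ := by simp [hw]
  -- A reflection carries ‖k‖e₀ to k and preserves the Gaussian and the volume.
  set T := (Submodule.span ℝ {w - k})ᗮ.reflection with hT
  have hTw : T w = k := Submodule.reflection_sub hnorm
  rw [← integral_coord_pow_mul_exp_neg_norm_sq, ← integral_const_mul,
    ← T.measurePreserving.integral_comp T.toHomeomorph.measurableEmbedding]
  refine integral_congr_ae (.of_forall fun x => ?_)
  simp only
  rw [← hTw, T.inner_map_map, T.norm_map, T.norm_map, hnorm]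
  have : (inner ℝ w x : ℝ) = ‖k‖ * x 0 := by simp [hw, EuclideanSpace.inner_single_left]
  rw [this]
  ring

/-- The surface measure of the unit sphere of `ℝ^(n+1)`. -/
noncomputable abbrev sphereMeasure (n : ℕ) :
    Measure (Metric.sphere (0 : EuclideanSpace ℝ (Fin (n + 1))) 1) := volume.toSphere

section Sphere

variable {n : ℕ} (k : EuclideanSpace ℝ (Fin (n + 1)))

/-- Homogeneity of the inner product separates angle from radius. With f Gaussian, the spherical
moment is a quotient of known integrals. -/
theorem integral_radial_mul_inner_pow (f : ℝ → ℝ) (m : ℕ) :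
    ∫ x : EuclideanSpace ℝ (Fin (n + 1)), f ‖x‖ * (inner ℝ k x : ℝ) ^ m =
      (∫ ω, (inner ℝ k ω.1 : ℝ) ^ m ∂sphereMeasure n) * ∫ r in Set.Ioi (0 : ℝ), r ^ n * (f r * r ^ m) := by
  have h1 : Module.finrank ℝ (EuclideanSpace ℝ (Fin (n + 1))) - 1 = n := by simp
  rw [integral_polar, h1]
  simp only [← smul_eq_mul (α := ℝ) (_ ^ n)]
  rw [← integral_volumeIoiPow n (fun r => f r * r ^ m), ← integral_prod_mul]
  refine integral_congr_ae (.of_forall fun p => ?_)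
  have hp : 0 < p.2.1 := p.2.2
  have hω : ‖p.1.1‖ = 1 := by simp
  simp only
  rw [norm_smul, hω, mul_one, Real.norm_eq_abs, abs_of_pos hp, inner_smul_right]
  ring

theorem integral_sphere_inner_even_pow (m : ℕ) :
    ∫ ω, (inner ℝ k ω.1 : ℝ) ^ (2 * m) ∂sphereMeasure n =
      2 * (‖k‖ ^ (2 * m) * (Real.Gamma (m + 1 / 2) * √Real.pi ^ n)) /
        Real.Gamma (m + ((n + 1 : ℕ) : ℝ) / 2) := by
  have h := integral_radial_mul_inner_pow k (fun r => Real.exp (-r ^ 2)) (2 * m)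
  have hr : ∀ r : ℝ, r ^ n * (Real.exp (-r ^ 2) * r ^ (2 * m)) =
      r ^ (n + 2 * m) * Real.exp (-r ^ 2) := fun r => by ring
  simp only [hr] at h
  rw [integral_inner_pow_mul_exp_neg_norm_sq, integral_pow_mul_exp_neg_sq_Ioi] at h
  have e : (((n + 2 * m : ℕ) : ℝ) + 1) / 2 = m + ((n + 1 : ℕ) : ℝ) / 2 := by push_cast; ring
  rw [e] at h
  have hG : 0 < Real.Gamma (m + ((n + 1 : ℕ) : ℝ) / 2) := Real.Gamma_pos_of_pos (by positivity)
  rw [eq_div_iff hG.ne', h]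
  ring

theorem integral_sphere_inner_odd_pow {m : ℕ} (hm : Odd m) :
    ∫ ω, (inner ℝ k ω.1 : ℝ) ^ m ∂sphereMeasure n = 0 := by
  have h := integral_radial_mul_inner_pow k (fun r => Real.exp (-r ^ 2)) m
  have h0 : ∫ x : EuclideanSpace ℝ (Fin (n + 1)),
      Real.exp (-‖x‖ ^ 2) * (inner ℝ k x : ℝ) ^ m = 0 := by
    have := integral_neg_eq_self (fun x : EuclideanSpace ℝ (Fin (n + 1)) =>
      Real.exp (-‖x‖ ^ 2) * (inner ℝ k x : ℝ) ^ m) volume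
    simp only [norm_neg, inner_neg_right, hm.neg_pow, mul_neg, integral_neg] at this
    linarith
  have hr : ∀ r : ℝ, r ^ n * (Real.exp (-r ^ 2) * r ^ m) =
      r ^ (n + m) * Real.exp (-r ^ 2) := fun r => by ring
  simp only [hr] at h
  rw [h0, integral_pow_mul_exp_neg_sq_Ioi] at h
  have hG : 0 < Real.Gamma ((((n + m : ℕ) : ℝ) + 1) / 2) := Real.Gamma_pos_of_pos (by positivity)
  have hG' : 1 / 2 * Real.Gamma ((((n + m : ℕ) : ℝ) + 1) / 2) ≠ 0 := by positivity
  exact (mul_eq_zero.1 h.symm).resolve_right hG'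

/-- The Fourier transform of the surface measure of the unit sphere. -/
theorem integral_sphere_exp (r : ℝ) :
    ∫ ω, Complex.exp (-(Complex.I * (r * (inner ℝ k ω.1 : ℝ) : ℝ))) ∂sphereMeasure n =
      ((2 * √Real.pi ^ (n + 1) *
        besselNorm (((n + 1 : ℕ) : ℝ) / 2 - 1) (r * ‖k‖) : ℝ) : ℂ) := by
  set G : ℕ → Metric.sphere (0 : EuclideanSpace ℝ (Fin (n + 1))) 1 → ℂ := fun m ω =>
    (-(Complex.I * (r * (inner ℝ k ω.1 : ℝ) : ℝ))) ^ m / m.factorial with hG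
  have hcont : ∀ m, Continuous (G m) := fun m => by
    simp only [hG]
    fun_prop
  have hbound : ∀ m ω, ‖G m ω‖ ≤ (|r| * ‖k‖) ^ m / m.factorial := fun m ω => by
    have hω : ‖ω.1‖ = 1 := by simp
    have := abs_real_inner_le_norm k ω.1
    rw [hω, mul_one] at this
    rw [hG, norm_div, norm_pow, norm_neg, norm_mul, Complex.norm_I, one_mul, Complex.norm_real,
      Complex.norm_natCast, Real.norm_eq_abs, abs_mul]
    gcongr
  have hint : ∀ m, Integrable (G m) (sphereMeasure n) := fun m =>
    Integrable.of_bound (hcont m).aestronglyMeasurable _ (.of_forall (hbound m))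
  have hsum : Summable fun m => ∫ ω, ‖G m ω‖ ∂sphereMeasure n := by
    refine Summable.of_nonneg_of_le (fun m => integral_nonneg fun _ => norm_nonneg _) (fun m => ?_)
      ((Real.summable_pow_div_factorial (|r| * ‖k‖)).mul_right (Measure.real (sphereMeasure n) Set.univ))
    refine (integral_mono (hint m).norm (integrable_const _) (hbound m)).trans ?_
    rw [integral_const, smul_eq_mul, mul_comm]
  have h1 := hasSum_integral_of_summable_integral_norm hint hsum
  have hexp : ∀ ω, ∑' m, G m ω =
      Complex.exp (-(Complex.I * (r * (inner ℝ k ω.1 : ℝ) : ℝ))) := fun ω => by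
    rw [Complex.exp_eq_exp_ℂ, NormedSpace.exp_eq_tsum_div]
  simp only [hexp] at h1
  have hterm : ∀ m, ∫ ω, G m ω ∂sphereMeasure n = (-(Complex.I * r)) ^ m / m.factorial *
      ((∫ ω, (inner ℝ k ω.1 : ℝ) ^ m ∂sphereMeasure n : ℝ) : ℂ) := fun m => by
    rw [← integral_complex_ofReal, ← integral_const_mul]
    refine integral_congr_ae (.of_forall fun ω => ?_)
    simp only [hG]
    push_cast
    ring
  have hodd : ∀ m ∉ Set.range (fun m : ℕ => 2 * m), ∫ ω, G m ω ∂sphereMeasure n = 0 := fun m hm => by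
    have : Odd m := by
      rw [← Nat.not_even_iff_odd]
      rintro ⟨j, rfl⟩
      exact hm ⟨j, by simp only; ring⟩
    rw [hterm, integral_sphere_inner_odd_pow k this]
    simp
  -- Only even powers survive; in them (2m)! cancels against Γ(m + 1/2), leaving the Bessel
  -- coefficients.
  rw [← (mul_right_injective₀ (two_ne_zero' ℕ)).hasSum_iff hodd] at h1
  rw [← h1.tsum_eq, besselNorm, besselClifford, ← tsum_mul_left, Complex.ofReal_tsum]
  refine tsum_congr fun m => ?_
  have hI : (-(Complex.I * r)) ^ (2 * m) = (((-1) ^ m * r ^ (2 * m) : ℝ) : ℂ) := by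
    rw [pow_mul, neg_sq, mul_pow, Complex.I_sq, pow_mul r]
    push_cast
    rw [mul_pow]
  have hf : (m.factorial : ℝ) ≠ 0 := by positivity
  have hf2 : ((2 * m).factorial : ℝ) ≠ 0 := by positivity
  have hGm : Real.Gamma (m + ((n + 1 : ℕ) : ℝ) / 2) ≠ 0 :=
    (Real.Gamma_pos_of_pos (by positivity)).ne'
  rw [Function.comp_apply, hterm, hI, integral_sphere_inner_even_pow, Gamma_natCast_add_half,
    besselCoeff, show (m : ℝ) + (((n + 1 : ℕ) : ℝ) / 2 - 1) + 1 = m + ((n + 1 : ℕ) : ℝ) / 2 by ring,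
    ← Complex.ofReal_natCast, ← Complex.ofReal_div, ← Complex.ofReal_mul]
  congr 1
  rw [← pow_mul, div_pow, pow_mul 2, show (2 : ℝ) ^ 2 = 4 by norm_num]
  field_simp
  ring

/-- The Fourier transform of an integrable radial function, in polar coordinates. -/
theorem integral_radial_mul_exp {f : ℝ → ℝ}
    (hf : Integrable fun x : EuclideanSpace ℝ (Fin (n + 1)) => f ‖x‖) :
    ∫ x : EuclideanSpace ℝ (Fin (n + 1)),
      (f ‖x‖ : ℂ) * Complex.exp (-(Complex.I * (inner ℝ k x : ℝ))) =
    ((2 * √Real.pi ^ (n + 1) * ∫ r in Set.Ioi (0 : ℝ),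
      r ^ n * (f r * besselNorm (((n + 1 : ℕ) : ℝ) / 2 - 1) (r * ‖k‖)) : ℝ) : ℂ) := by
  have h1 : Module.finrank ℝ (EuclideanSpace ℝ (Fin (n + 1))) - 1 = n := by simp
  have hg : Integrable fun x : EuclideanSpace ℝ (Fin (n + 1)) =>
      (f ‖x‖ : ℂ) * Complex.exp (-(Complex.I * (inner ℝ k x : ℝ))) := by
    refine hf.ofReal.mul_bdd (c := 1)
      (by fun_prop : Continuous _).aestronglyMeasurable (.of_forall fun x => ?_)
    rw [← mul_neg, ← Complex.ofReal_neg, mul_comm, Complex.norm_exp_ofReal_mul_I]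
  have hp := integrable_polar volume hg
  rw [integral_polar, integral_prod_symm _ hp, h1]
  rw [← integral_const_mul, ← integral_complex_ofReal]
  have hin : ∀ r : Set.Ioi (0 : ℝ), ∫ ω : Metric.sphere (0 : EuclideanSpace ℝ (Fin (n + 1))) 1,
      (f ‖r.1 • ω.1‖ : ℂ) * Complex.exp (-(Complex.I * (inner ℝ k (r.1 • ω.1) : ℝ))) ∂sphereMeasure n =
      (fun r : ℝ => (f r : ℂ) * ((2 * √Real.pi ^ (n + 1) *
        besselNorm (((n + 1 : ℕ) : ℝ) / 2 - 1) (r * ‖k‖) : ℝ) : ℂ)) r.1 := fun r => by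
    simp only
    rw [← integral_sphere_exp, ← integral_const_mul]
    refine integral_congr_ae (.of_forall fun ω => ?_)
    have hω : ‖ω.1‖ = 1 := by simp
    have hr : 0 < r.1 := r.2
    simp only
    rw [norm_smul, hω, mul_one, Real.norm_eq_abs, abs_of_pos hr, inner_smul_right]
  simp only [hin]
  rw [integral_volumeIoiPow n (fun r : ℝ => (f r : ℂ) * ((2 * √Real.pi ^ (n + 1) *
        besselNorm (((n + 1 : ℕ) : ℝ) / 2 - 1) (r * ‖k‖) : ℝ) : ℂ))]
  refine setIntegral_congr_fun measurableSet_Ioi fun r _ => ?_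
  simp only [Complex.real_smul]
  push_cast
  ring

end Sphere

/-! ### Radial functions on balls -/

section Ball

variable {n : ℕ} (k : EuclideanSpace ℝ (Fin (n + 1)))

/-- The Fourier transform of a continuous radial function cut off to a centred ball. -/
theorem setIntegral_ball_radial_mul_exp {g : ℝ → ℝ} (hg : Continuous g) {R : ℝ} (hR : 0 ≤ R) :
    ∫ x in Metric.ball (0 : EuclideanSpace ℝ (Fin (n + 1))) R,
      (g ‖x‖ : ℂ) * Complex.exp (-(Complex.I * (inner ℝ k x : ℝ))) =
    ((2 * √Real.pi ^ (n + 1) * ∫ r in (0 : ℝ)..R,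
      r ^ n * (g r * besselNorm (((n + 1 : ℕ) : ℝ) / 2 - 1) (r * ‖k‖)) : ℝ) : ℂ) := by
  have hball : Integrable fun x : EuclideanSpace ℝ (Fin (n + 1)) => (Set.Iio R).indicator g ‖x‖ := by
    have h1 : IntegrableOn (fun x : EuclideanSpace ℝ (Fin (n + 1)) => g ‖x‖) (Metric.ball 0 R) :=
      ((hg.comp continuous_norm).continuousOn.integrableOn_compact
        (isCompact_closedBall 0 R)).mono_set Metric.ball_subset_closedBall
    refine ((integrable_indicator_iff measurableSet_ball).2 h1).congr (.of_forall fun x => ?_)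
    simp [Set.indicator]
  have h := integral_radial_mul_exp k hball
  have e1 : ∀ x : EuclideanSpace ℝ (Fin (n + 1)), (((Set.Iio R).indicator g ‖x‖ : ℝ) : ℂ) *
      Complex.exp (-(Complex.I * (inner ℝ k x : ℝ))) = (Metric.ball 0 R).indicator (fun x =>
      (g ‖x‖ : ℂ) * Complex.exp (-(Complex.I * (inner ℝ k x : ℝ)))) x := fun x => by
    by_cases hx : ‖x‖ < R <;> simp [Set.indicator, hx]
  have e2 : ∀ r : ℝ, r ^ n * ((Set.Iio R).indicator g r *
      besselNorm (((n + 1 : ℕ) : ℝ) / 2 - 1) (r * ‖k‖)) = (Set.Iio R).indicator (fun r =>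
      r ^ n * (g r * besselNorm (((n + 1 : ℕ) : ℝ) / 2 - 1) (r * ‖k‖))) r := fun r => by
    by_cases hr : r < R <;> simp [Set.indicator, hr]
  simp only [e1, e2] at h
  rw [integral_indicator measurableSet_ball, setIntegral_indicator measurableSet_Iio,
    Set.Ioi_inter_Iio] at h
  rw [h, intervalIntegral.integral_of_le hR, integral_Ioc_eq_integral_Ioo]

/-- The Fourier transform of the indicator function of a ball. -/
theorem setIntegral_ball_exp {R : ℝ} (hR : 0 ≤ R) :
    ∫ x in Metric.ball (0 : EuclideanSpace ℝ (Fin (n + 1))) R,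
      Complex.exp (-(Complex.I * (inner ℝ k x : ℝ))) =
    (((√Real.pi * R) ^ (n + 1) * besselNorm (((n + 1 : ℕ) : ℝ) / 2) (‖k‖ * R) : ℝ) : ℂ) := by
  have h := setIntegral_ball_radial_mul_exp k (g := fun _ => 1) continuous_const hR
  simp only [Complex.ofReal_one, one_mul] at h
  rw [h]
  congr 1
  have hc := continuous_besselNorm (((n + 1 : ℕ) : ℝ) / 2 - 1)
  -- The radial integrand is, up to 2^n, an exact derivative, which raises the order by one.
  have h2 := intervalIntegral.integral_eq_sub_of_hasDerivAt
    (fun ρ (_ : ρ ∈ Set.uIcc 0 R) => hasDerivAt_pow_mul_besselNorm n ‖k‖ ρ)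
    ((by fun_prop : Continuous _).intervalIntegrable _ _)
  have e : ∀ r : ℝ, r ^ n * besselNorm (((n + 1 : ℕ) : ℝ) / 2 - 1) (r * ‖k‖) =
      2 ^ n * ((r / 2) ^ n * besselNorm (((n + 1 : ℕ) : ℝ) / 2 - 1) (‖k‖ * r)) := fun r => by
    rw [div_pow, mul_comm r ‖k‖]
    field_simp
  simp only [e]
  rw [intervalIntegral.integral_const_mul, h2, zero_div, zero_pow n.succ_ne_zero, div_pow, mul_pow]
  field_simp
  ring

end Ball

/-! ### Application to the regularization function -/

theorem rpow_natCast_div_two {a : ℝ} (ha : 0 ≤ a) (d : ℕ) : a ^ ((d : ℝ) / 2) = √a ^ d := by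
  rw [Real.sqrt_eq_rpow, ← Real.rpow_natCast, ← Real.rpow_mul ha]
  congr 1
  ring

theorem zeta_eq (d : ℕ) {σ ρ : ℝ} (hσ : 0 < σ) (hρ : 0 < ρ) :
    zeta d σ ρ = ((2 * √Real.pi * σ) ^ d)⁻¹ * besselNorm ((d : ℝ) / 2) ρ := by
  have hπ := Real.pi_pos
  have h : ρ / 2 = (2 * Real.pi * σ ^ 2 * ρ) * ((2 * √Real.pi * σ) ^ 2)⁻¹ := by
    rw [mul_pow, mul_pow, Real.sq_sqrt hπ.le]
    field_simp
  have h1 : (2 * Real.pi * σ ^ 2 * ρ) ^ ((d : ℝ) / 2) ≠ 0 := by positivity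
  rw [zeta, besselJ_eq _ hρ, h, Real.mul_rpow (by positivity) (by positivity),
    rpow_natCast_div_two (a := ((2 * √Real.pi * σ) ^ 2)⁻¹) (by positivity), Real.sqrt_inv,
    Real.sqrt_sq (by positivity), inv_pow]
  field_simp

theorem zeta_mul_bessel_eq {d : ℕ} (hd : 0 < d) {σ s ρ : ℝ} (hσ : 0 < σ) (hs : 0 < s)
    (hρ : 0 < ρ) :
    zeta d σ ρ * (besselJ ((d : ℝ) / 2 - 1) (s * ρ) / (s * ρ) ^ ((d : ℝ) / 2 - 1)) * ρ ^ (d - 1) =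
      ((2 * Real.pi * σ ^ 2) ^ ((d : ℝ) / 2))⁻¹ * ((ρ / 2) ^ (d - 1) *
        (besselNorm ((d : ℝ) / 2) ρ * besselNorm ((d : ℝ) / 2 - 1) (s * ρ))) := by
  have hπ := Real.pi_pos
  have hsρ : 0 < s * ρ := mul_pos hs hρ
  have h1 : (s * ρ) ^ ((d : ℝ) / 2 - 1) ≠ 0 := (Real.rpow_pos_of_pos hsρ _).ne'
  -- Half-integer powers become natural powers of square roots, so that the rest is field
  -- arithmetic.
  have h2 : (2 : ℝ) ^ ((d : ℝ) / 2 - 1) * 2 = √2 ^ d := by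
    rw [Real.rpow_sub_one two_ne_zero, rpow_natCast_div_two two_pos.le]
    field_simp
  obtain ⟨n, rfl⟩ := Nat.exists_eq_add_of_lt hd
  rw [zero_add] at *
  have h3 : √(2 : ℝ) ^ (n + 1) * √2 ^ (n + 1) = 2 ^ (n + 1) := by
    rw [← mul_pow, Real.mul_self_sqrt two_pos.le]
  have h4 : √(2 * Real.pi * σ ^ 2) = √2 * √Real.pi * σ := by
    rw [Real.sqrt_mul (by positivity), Real.sqrt_mul (by positivity), Real.sqrt_sq hσ.le]
  have h5 : (2 : ℝ) ^ (((n + 1 : ℕ) : ℝ) / 2 - 1) = √2 ^ (n + 1) / 2 := by rw [← h2]; ring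
  rw [zeta_eq _ hσ hρ, besselJ_eq _ hsρ, Real.div_rpow hsρ.le two_pos.le,
    rpow_natCast_div_two (a := 2 * Real.pi * σ ^ 2) (by positivity), h4, h5, Nat.add_sub_cancel,
    mul_pow, mul_pow, mul_pow, mul_pow, div_pow, ← h3]
  have h6 : (2 : ℝ) ^ n = √2 ^ (n + 1) * √2 ^ (n + 1) / 2 := by rw [h3, pow_succ]; ring
  rw [h6]
  field_simp

theorem cutoff_inv {σ : ℝ} (hσ : 0 < σ) (k : ℝ) : cutoff σ⁻¹ k = cutoff 1 (σ * k) := by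
  have h1 : k < σ⁻¹ ↔ σ * k < 1 := by rw [← one_div, lt_div_iff₀' hσ]
  have h2 : k = σ⁻¹ ↔ σ * k = 1 := by rw [← one_div, eq_div_iff hσ.ne', mul_comm]
  simp only [cutoff, h1, h2]

theorem hasRadialFourierTransformAt_zeta {d : ℕ} (hd : 0 < d) {σ s : ℝ} (hσ : 0 < σ)
    (hs : 0 < s) : HasRadialFourierTransformAt d σ (zeta d σ) s (cutoff 1 s) := by
  have hπ := Real.pi_pos
  have hc := continuous_radialIntegrand d s
  have hA : (2 * Real.pi * σ ^ 2) ^ ((d : ℝ) / 2) ≠ 0 := by positivity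
  refine ⟨fun R hR => ?_, ?_⟩
  · refine ((hc.const_mul ((2 * Real.pi * σ ^ 2) ^ ((d : ℝ) / 2))⁻¹).intervalIntegrable
      0 R).congr fun ρ hρ => ?_
    -- The half-open interval omits ρ = 0, where the closed form is not available.
    rw [Set.uIoc_of_le hR.le] at hρ
    exact (zeta_mul_bessel_eq hd hσ hs hρ.1).symm
  · refine (tendsto_radialIntegral hd hs).congr' ?_
    filter_upwards [eventually_gt_atTop 0] with R hR
    rw [radialIntegral, ← mul_right_inj' (inv_ne_zero hA), inv_mul_cancel_left₀ hA,
      ← intervalIntegral.integral_const_mul]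
    refine intervalIntegral.integral_congr_ae (.of_forall fun ρ hρ => ?_)
    rw [Set.uIoc_of_le hR.le] at hρ
    exact (zeta_mul_bessel_eq hd hσ hs hρ.1).symm

theorem zeta_norm_div_ae_eq {n : ℕ} {σ : ℝ} (hσ : 0 < σ) :
    (fun x : EuclideanSpace ℝ (Fin (n + 1)) => zeta (n + 1) σ (‖x‖ / σ)) =ᵐ[volume] fun x =>
      ((2 * √Real.pi * σ) ^ (n + 1))⁻¹ * besselNorm (((n + 1 : ℕ) : ℝ) / 2) (‖x‖ / σ) := by
  filter_upwards [compl_mem_ae_iff.2 (measure_singleton (0 : EuclideanSpace ℝ (Fin (n + 1))))]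
    with x hx
  exact zeta_eq _ hσ (div_pos (norm_pos_iff.2 hx) hσ)

theorem hasFourierTransformAt_zeta {n : ℕ} {σ : ℝ} (hσ : 0 < σ)
    {k : EuclideanSpace ℝ (Fin (n + 1))} (hk : k ≠ 0) :
    HasFourierTransformAt (fun x => (zeta (n + 1) σ (‖x‖ / σ) : ℂ)) k
      (cutoff 1 (σ * ‖k‖) : ℂ) := by
  have hc := continuous_besselNorm (((n + 1 : ℕ) : ℝ) / 2)
  have hc' := continuous_besselNorm (((n + 1 : ℕ) : ℝ) / 2 - 1)
  have hπ := Real.pi_pos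
  have hae := zeta_norm_div_ae_eq (n := n) hσ
  refine ⟨fun R => ?_, ?_⟩
  · have h1 : IntegrableOn (fun x : EuclideanSpace ℝ (Fin (n + 1)) =>
        ((2 * √Real.pi * σ) ^ (n + 1))⁻¹ * besselNorm (((n + 1 : ℕ) : ℝ) / 2) (‖x‖ / σ))
        (Metric.ball 0 R) :=
      ((by fun_prop : Continuous _).continuousOn.integrableOn_compact
        (isCompact_closedBall 0 R)).mono_set Metric.ball_subset_closedBall
    exact (h1.congr (ae_restrict_of_ae hae.symm)).ofReal
  · have hlim := ((tendsto_radialIntegral n.succ_pos (mul_pos hσ (norm_pos_iff.2 hk))).comp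
      (tendsto_id.atTop_div_const hσ))
    refine ((Complex.continuous_ofReal.tendsto _).comp hlim).congr' ?_
    filter_upwards [eventually_gt_atTop 0] with R hR
    have h := setIntegral_ball_radial_mul_exp k (g := fun r => ((2 * √Real.pi * σ) ^ (n + 1))⁻¹ *
      besselNorm (((n + 1 : ℕ) : ℝ) / 2) (r / σ)) (by fun_prop) hR.le
    have e : ∫ x in Metric.ball (0 : EuclideanSpace ℝ (Fin (n + 1))) R,
        (zeta (n + 1) σ (‖x‖ / σ) : ℂ) * Complex.exp (-(Complex.I * (inner ℝ k x : ℝ))) =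
        ∫ x in Metric.ball (0 : EuclideanSpace ℝ (Fin (n + 1))) R,
          ((((2 * √Real.pi * σ) ^ (n + 1))⁻¹ *
            besselNorm (((n + 1 : ℕ) : ℝ) / 2) (‖x‖ / σ) : ℝ) : ℂ) *
            Complex.exp (-(Complex.I * (inner ℝ k x : ℝ))) :=
      integral_congr_ae (ae_restrict_of_ae (hae.mono fun x hx => by simp only [hx]))
    rw [e, h]
    simp only [Function.comp, id, Nat.succ_eq_add_one]
    congr 1
    set Φ : ℝ → ℝ := fun ρ => (ρ / 2) ^ (n + 1 - 1) * (besselNorm (((n + 1 : ℕ) : ℝ) / 2) ρ *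
      besselNorm (((n + 1 : ℕ) : ℝ) / 2 - 1) (σ * ‖k‖ * ρ)) with hΦ
    have e2 : ∀ r : ℝ, r ^ n * (((2 * √Real.pi * σ) ^ (n + 1))⁻¹ *
        besselNorm (((n + 1 : ℕ) : ℝ) / 2) (r / σ) *
        besselNorm (((n + 1 : ℕ) : ℝ) / 2 - 1) (r * ‖k‖)) =
        (2 * √Real.pi ^ (n + 1))⁻¹ * σ⁻¹ * Φ (r / σ) := fun r => by
      have : σ * ‖k‖ * (r / σ) = r * ‖k‖ := by field_simp
      simp only [hΦ, this, Nat.add_sub_cancel]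
      rw [mul_pow, mul_pow, div_pow, div_pow]
      field_simp
      ring
    rw [intervalIntegral.integral_congr fun r _ => e2 r,
      intervalIntegral.integral_const_mul, intervalIntegral.integral_comp_div Φ hσ.ne',
      zero_div, smul_eq_mul,
      show radialIntegral (n + 1) (σ * ‖k‖) (R / σ) = ∫ ρ in (0 : ℝ)..R / σ, Φ ρ from rfl]
    field_simp

theorem zeta_eq_inverse_fourier {n : ℕ} {σ : ℝ} (hσ : 0 < σ)
    {x : EuclideanSpace ℝ (Fin (n + 1))} (hx : x ≠ 0) :
    (zeta (n + 1) σ (‖x‖ / σ) : ℂ) = ((2 * Real.pi : ℝ) : ℂ)⁻¹ ^ (n + 1) *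
      ∫ k : EuclideanSpace ℝ (Fin (n + 1)),
        (cutoff σ⁻¹ ‖k‖ : ℂ) * Complex.exp (Complex.I * (inner ℝ k x : ℝ)) := by
  have hπ := Real.pi_pos
  have hσ' := inv_pos.2 hσ
  -- The sphere ‖k‖ = σ⁻¹ is null, so the value 1/2 there is immaterial; replacing x by -x matches
  -- the sign of the exponent.
  have hae : ∀ᵐ k : EuclideanSpace ℝ (Fin (n + 1)), (cutoff σ⁻¹ ‖k‖ : ℂ) *
      Complex.exp (Complex.I * (inner ℝ k x : ℝ)) = (Metric.ball 0 σ⁻¹).indicator (fun k =>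
        Complex.exp (-(Complex.I * (inner ℝ (-x) k : ℝ)))) k := by
    filter_upwards [compl_mem_ae_iff.2 (Measure.addHaar_sphere volume
      (0 : EuclideanSpace ℝ (Fin (n + 1))) σ⁻¹)] with k hk
    have hk' : ‖k‖ ≠ σ⁻¹ := by simpa using hk
    rw [cutoff, if_neg hk', real_inner_comm]
    by_cases h : ‖k‖ < σ⁻¹ <;> simp [Set.indicator, h]
  rw [integral_congr_ae hae, integral_indicator measurableSet_ball,
    setIntegral_ball_exp _ hσ'.le, zeta_eq _ hσ (div_pos (norm_pos_iff.2 hx) hσ), norm_neg,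
    ← Complex.ofReal_inv, ← Complex.ofReal_pow, ← Complex.ofReal_mul, ← div_eq_mul_inv ‖x‖,
    ← mul_assoc, ← mul_pow, ← inv_pow]
  have : (2 * √Real.pi * σ)⁻¹ = (2 * Real.pi)⁻¹ * (√Real.pi * σ⁻¹) := by
    have h := Real.mul_self_sqrt hπ.le
    nth_rewrite 2 [← h]
    field_simp
  rw [this]

end SpectralCutoff

theorem mainTheorem4 (d : ℕ) (hd : 0 < d) (h : ℝ) (hh : 0 < h) :
    -- the radial (polar-coordinate) Fourier transform of `ζ`, at `s = σ k`
    (∀ k : ℝ, 0 < k →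
      SpectralCutoff.HasRadialFourierTransformAt d (SpectralCutoff.sigma h)
        (SpectralCutoff.zeta d (SpectralCutoff.sigma h)) (SpectralCutoff.sigma h * k)
        (SpectralCutoff.cutoff (SpectralCutoff.samplingWavenumber h / 2) k)) ∧
    -- the Fourier transform over `ℝ^d` of `x ↦ ζ(|x| / σ)`
    (∀ k : EuclideanSpace ℝ (Fin d), k ≠ 0 →
      SpectralCutoff.HasFourierTransformAt
        (fun x : EuclideanSpace ℝ (Fin d) =>
          (SpectralCutoff.zeta d (SpectralCutoff.sigma h) (‖x‖ / SpectralCutoff.sigma h) : ℂ)) k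
        (SpectralCutoff.cutoff (SpectralCutoff.samplingWavenumber h / 2) ‖k‖ : ℂ)) ∧
    -- `ζ(|x| / σ)` is the inverse Fourier transform of the cut-off
    (∀ x : EuclideanSpace ℝ (Fin d), x ≠ 0 →
      (SpectralCutoff.zeta d (SpectralCutoff.sigma h) (‖x‖ / SpectralCutoff.sigma h) : ℂ) =
        ((2 * Real.pi : ℝ) : ℂ)⁻¹ ^ d *
          ∫ k : EuclideanSpace ℝ (Fin d),
            (SpectralCutoff.cutoff (SpectralCutoff.samplingWavenumber h / 2) ‖k‖ : ℂ) *
              Complex.exp (Complex.I * (inner ℝ k x : ℝ))) := by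
  have hσ : 0 < SpectralCutoff.sigma h := div_pos hh Real.pi_pos
  have hK : SpectralCutoff.samplingWavenumber h / 2 = (SpectralCutoff.sigma h)⁻¹ := by
    rw [SpectralCutoff.samplingWavenumber, SpectralCutoff.sigma]
    field_simp
  rw [hK]
  refine ⟨fun k hk => ?_, fun k hk => ?_, fun x hx => ?_⟩
  · rw [SpectralCutoff.cutoff_inv hσ]
    exact SpectralCutoff.hasRadialFourierTransformAt_zeta hd hσ (mul_pos hσ hk)
  · obtain ⟨n, rfl⟩ := Nat.exists_eq_succ_of_ne_zero hd.ne'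
    rw [SpectralCutoff.cutoff_inv hσ]
    exact SpectralCutoff.hasFourierTransformAt_zeta hσ hk
  · obtain ⟨n, rfl⟩ := Nat.exists_eq_succ_of_ne_zero hd.ne'
    exact SpectralCutoff.zeta_eq_inverse_fourier hσ hx
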